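/- **Circuit model.** Let $n\ge 0$ and $L\ge 1$. A noisy random circuit of depth $L$ on $n$ qubits is $$\Phi=\mathcal V\circ\mathcal N^{\otimes n}\circ\mathcal U_L\circ\cdots\circ\mathcal N^{\otimes n}\circ\mathcal U_1,$$ where each $\mathcal U_l$ is conjugation by a product of finitely many two-qubit gates, placed on arbitrary pairs of distinct qubits such that every qubit is acted on by at least one of them; $\mathcal V$ is conjugation by a tensor product of single-qubit gates; all gates are independent and each is drawn from a unitary 2-design (on $\mathrm U(4)$, respectively $\mathrm U(2)$); and $\mathcal N$ is a single-qubit quantum channel (completely positive, trace preserving). Let $\mathbf t=(t_X,t_Y,t_Z)$, $\mathbf D=(D_X,D_Y,D_Z)\in\mathbb R^3$ be normal-form parameters of $\mathcal N$: there are unitaries $U,V$ and a linear map $\mathcal N'$ with $\mathcal N(A)=U\mathcal N'(V^\dagger AV)U^\dagger$ for all $A$, $\mathcal N'(I)=I+t_XX+t_YY+t_ZZ$ and $\mathcal N'(Q)=D_QQ$ for $Q\in\{X,Y,Z\}$. Put $c=\frac13(\|\mathbf t\|_2^2+\|\mathbf D\|_2^2)$. For $P\in\{I,X,Y,Z\}^{\otimes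 n}$ let $|P|$ be the number of non-identity tensor factors, and let $I_n$ be the identity string. Let $\rho$ be any $n$-qubit state, $H=\sum_P a_PP$ with $a_P\in\mathbb R$ arbitrary, and let $\mathrm{Var}$ be the variance over the random gates. **Theorem.** 1. For every such noise channel, at every depth $L\ge1$, $$\sum_{P\ne I_n}a_P^2\Big(\frac{\|\mathbf t\|_2^2}{3}\Big)^{|P|}\;\le\;\mathrm{Var}[\mathrm{Tr}(H\Phi(\rho))]\;\le\;\sum_{P\ne I_n}a_P^2\,c^{|P|}.$$ If $\mathcal N$ is non-unital ($\mathcal N(I)\ne I$), then $0<\|\mathbf t\|_2^2/3\le c<1$. 2. For every $\tau>0$ there are constants $\alpha\ge\beta>0$, depending only on $\tau$, such that for all $n$, all $L\ge 1$, all circuit geometries and 2-designs, all noise channels with $\|\mathbf t\|_2\ge\tau$, and all states $\rho$, there is a function $f$ on Pauli strings with $\beta|P|\le f(P)\le\alpha|P|$ for every $P\neq I_n$ and, for every $H=\sum_Pa_PP$, $$\mathrm{Var}[\mathrm{Tr}(H\Phi(\rho))]=\sum_{P\ne I_n}a_P^2\,e^{-f(P)},$$ that is, $\mathrm{Var}[\mathrm{Tr}(H\Phi(\rho))]=\sum_{P\neq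 I_n}a_P^2\exp(-\Theta(|P|))$. 3. (Local observables are not exponentially concentrated.) For every $\tau>0$ and $k\in\mathbb N$ there is $\delta>0$, depending only on $\tau,k$, such that, in the setting of 2, if $a_P=0$ whenever $|P|>k$, then $\delta\sum_{P\ne I_n}a_P^2\le\mathrm{Var}[\mathrm{Tr}(H\Phi(\rho))]\le\sum_{P\ne I_n}a_P^2$. 4. (Global observables are exponentially concentrated.) For every $\tau>0$ and $\gamma>0$ there are $\alpha\ge\beta>0$, depending only on $\tau,\gamma$, such that, in the setting of 2, if $|P|\ge\gamma n$ for every $P\ne I_n$ with $a_P\neq0$, then $e^{-\alpha n}\sum_{P\ne I_n}a_P^2\le\mathrm{Var}[\mathrm{Tr}(H\Phi(\rho))]\le e^{-\beta n}\sum_{P\ne I_n}a_P^2$. -/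

import Mathlib

open MeasureTheory ProbabilityTheory
open scoped Kronecker ComplexOrder BigOperators

noncomputable section

namespace NoisyCircuit

/-! ### The unitary group with its Borel σ-algebra and Haar measure; 2-designs -/

/-- The unitary group `U(d)`, with the computational basis indexed by `d`. -/
abbrev U (d : Type) [Fintype d] [DecidableEq d] : Type := Matrix.unitaryGroup d ℂ

instance instMeasurableSpaceU (d : Type) [Fintype d] [DecidableEq d] : MeasurableSpace (U d) :=
  borel _

instance instBorelSpaceU (d : Type) [Fintype d] [DecidableEq d] : BorelSpace (U d) := ⟨rfl⟩

instance instCompactSpaceU (d : Type) [Fintype d] [DecidableEq d] : CompactSpace (U d) := by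
  have hcl : IsClosed (Matrix.unitaryGroup d ℂ : Set (Matrix d d ℂ)) := by
    have : (Matrix.unitaryGroup d ℂ : Set (Matrix d d ℂ)) =
        {A | star A * A = 1} ∩ {A | A * star A = 1} := by
      ext A
      exact Unitary.mem_iff
    rw [this]
    exact (isClosed_eq (by fun_prop) (by fun_prop)).inter
      (isClosed_eq (by fun_prop) (by fun_prop))
  have hK : IsCompact (Set.univ.pi fun _ : d => Set.univ.pi fun _ : d =>
      Metric.closedBall (0 : ℂ) 1) :=
    isCompact_univ_pi fun _ => isCompact_univ_pi fun _ => isCompact_closedBall _ _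
  refine isCompact_iff_compactSpace.mp (hK.of_isClosed_subset hcl ?_)
  intro A hA i _ j _
  simpa using entry_norm_bound_of_unitary hA i j

/-- The normalized Haar measure on `U(d)`. -/
def haar (d : Type) [Fintype d] [DecidableEq d] : Measure (U d) := Measure.haarMeasure ⊤

/-- `E_{V ∼ ν} [V^{⊗2} O (V^{⊗2})†]`, entry by entry. -/
def twirl {d : Type} [Fintype d] [DecidableEq d] (ν : Measure (U d))
    (O : Matrix (d × d) (d × d) ℂ) : Matrix (d × d) (d × d) ℂ :=
  Matrix.of fun p q =>
    ∫ V, (((V : Matrix d d ℂ) ⊗ₖ (V : Matrix d d ℂ)) * O *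
      ((V : Matrix d d ℂ) ⊗ₖ (V : Matrix d d ℂ)).conjTranspose) p q ∂ν

/-- Unitary 2-designs: probability measures with the second moments of the Haar measure. -/
structure IsTwoDesign {d : Type} [Fintype d] [DecidableEq d] (ν : Measure (U d)) : Prop where
  isProbabilityMeasure : IsProbabilityMeasure ν
  twirl_eq : ∀ O : Matrix (d × d) (d × d) ℂ, twirl ν O = twirl (haar d) O

/-! ### Pauli strings, observables and states -/

/-- Computational basis labels of `n` qubits. -/
abbrev Bits (n : ℕ) : Type := Fin n → Fin 2

/-- Operators on `n` qubits. -/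
abbrev Op (n : ℕ) : Type := Matrix (Bits n) (Bits n) ℂ

/-- The Pauli matrices `I, X, Y, Z`, in this order. -/
def pauli : Fin 4 → Matrix (Fin 2) (Fin 2) ℂ :=
  ![!![1, 0; 0, 1], !![0, 1; 1, 0], !![0, -Complex.I; Complex.I, 0], !![1, 0; 0, -1]]

/-- The tensor product of `n` single-qubit operators. -/
def tensor {n : ℕ} (A : Fin n → Matrix (Fin 2) (Fin 2) ℂ) : Op n :=
  Matrix.of fun x y => ∏ i, A i (x i) (y i)

/-- Labels of the elements of `{I, X, Y, Z}^{⊗ n}`; the zero label is the identity. -/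
abbrev PauliString (n : ℕ) : Type := Fin n → Fin 4

/-- The operator of a Pauli string. -/
def pauliOp {n : ℕ} (P : PauliString n) : Op n := tensor fun i => pauli (P i)

/-- The Pauli weight `|P|`: the number of non-identity tensor factors. -/
def weight {n : ℕ} (P : PauliString n) : ℕ := (Finset.univ.filter fun i => P i ≠ 0).card

/-- The Hamiltonian `∑_P a_P P`. -/
def hamiltonian {n : ℕ} (a : PauliString n → ℝ) : Op n := ∑ P, (a P : ℂ) • pauliOp P

/-- Density matrices. -/
structure IsState {n : ℕ} (ρ : Op n) : Prop where
  posSemidef : ρ.PosSemidef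
  trace_eq_one : ρ.trace = 1

/-- The expectation value `Tr(H ρ)`, which is real for Hermitian `H` and `ρ`. -/
def expVal {n : ℕ} (H ρ : Op n) : ℝ := (H * ρ).trace.re

/-! ### Single-qubit noise channels -/

/-- Linear maps on single-qubit operators. -/
abbrev QubitMap : Type := Matrix (Fin 2) (Fin 2) ℂ →ₗ[ℂ] Matrix (Fin 2) (Fin 2) ℂ

/-- `N ⊗ id` on the tensor product of a qubit and a `k`-dimensional system. -/
def ampliation (N : QubitMap) (k : ℕ) (σ : Matrix (Fin 2 × Fin k) (Fin 2 × Fin k) ℂ) :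
    Matrix (Fin 2 × Fin k) (Fin 2 × Fin k) ℂ :=
  Matrix.of fun p q => N (Matrix.of fun a b => σ (a, p.2) (b, q.2)) p.1 q.1

/-- Quantum channels: completely positive and trace-preserving linear maps. -/
structure IsChannel (N : QubitMap) : Prop where
  completelyPositive : ∀ (k : ℕ) (σ : Matrix (Fin 2 × Fin k) (Fin 2 × Fin k) ℂ),
    σ.PosSemidef → (ampliation N k σ).PosSemidef
  tracePreserving : ∀ A, (N A).trace = A.trace

/-- `(t, D)` are normal-form parameters of `N`: up to unitary rotations before and after, `N` is
the map `N'` with `N'(I) = I + t_X X + t_Y Y + t_Z Z` and `N'(Q) = D_Q Q` for `Q = X, Y, Z`.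
No normalization of the signs of the entries of `D` is required. -/
def HasNormalForm (N : QubitMap) (t D : EuclideanSpace ℝ (Fin 3)) : Prop :=
  ∃ (u v : U (Fin 2)) (N' : QubitMap),
    N' (pauli 0) = pauli 0 + ∑ k : Fin 3, (t k : ℂ) • pauli k.succ ∧
    (∀ k : Fin 3, N' (pauli k.succ) = (D k : ℂ) • pauli k.succ) ∧
    ∀ A, N A = (u : Matrix (Fin 2) (Fin 2) ℂ) *
      N' ((v : Matrix (Fin 2) (Fin 2) ℂ).conjTranspose * A * (v : Matrix (Fin 2) (Fin 2) ℂ)) *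
      (u : Matrix (Fin 2) (Fin 2) ℂ).conjTranspose

/-- `c = (‖t‖² + ‖D‖²) / 3`. -/
def contractionCoeff (t D : EuclideanSpace ℝ (Fin 3)) : ℝ := (‖t‖ ^ 2 + ‖D‖ ^ 2) / 3

/-- `N^{⊗ n}` acting on `n`-qubit operators: the linear extension of
`|x⟩⟨y| ↦ ⨂ᵢ N(|xᵢ⟩⟨yᵢ|)`. -/
def tensorChannel (N : QubitMap) {n : ℕ} (A : Op n) : Op n :=
  ∑ x, ∑ y, A x y • tensor fun i => N (Matrix.single (x i) (y i) 1)

/-! ### Noisy random circuits -/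

/-- The two-qubit gate `g` applied to the ordered pair of qubits `(i, j)`, and the identity on all
other qubits. -/
def applyPair {n : ℕ} (i j : Fin n) (g : Matrix (Fin 2 × Fin 2) (Fin 2 × Fin 2) ℂ) : Op n :=
  Matrix.of fun x y =>
    if ∀ k, k ≠ i → k ≠ j → x k = y k then g (x i, x j) (y i, y j) else 0

/-- The geometry of a layer of two-qubit gates, together with the distributions of its gates:
a finite sequence of gates, each placed on a pair of distinct qubits and drawn from a 2-design,
such that every qubit is acted on by at least one of the gates. -/
structure Layer (n : ℕ) where
  numGates : ℕ
  fst : Fin numGates → Fin n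
  snd : Fin numGates → Fin n
  fst_ne_snd : ∀ g, fst g ≠ snd g
  covers : ∀ i, ∃ g, fst g = i ∨ snd g = i
  gateLaw : Fin numGates → Measure (U (Fin 2 × Fin 2))
  gateLaw_isTwoDesign : ∀ g, IsTwoDesign (gateLaw g)

/-- The unitary of a layer for given gates, the gate of index `0` being applied first. -/
def Layer.unitary {n : ℕ} (ℓ : Layer n) (u : Fin ℓ.numGates → U (Fin 2 × Fin 2)) : Op n :=
  Fin.foldl ℓ.numGates (fun W g => applyPair (ℓ.fst g) (ℓ.snd g) (u g).1 * W) 1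

/-- An `n`-qubit random circuit ensemble of depth `L`: `L` layers of random two-qubit gates and a
final layer of random single-qubit gates, all drawn from 2-designs. -/
structure RandomCircuit (n L : ℕ) where
  layer : Fin L → Layer n
  singleLaw : Fin n → Measure (U (Fin 2))
  singleLaw_isTwoDesign : ∀ i, IsTwoDesign (singleLaw i)

namespace RandomCircuit

variable {n L : ℕ}

/-- A choice of all the gates of the circuit. -/
abbrev Gates (C : RandomCircuit n L) : Type :=
  ((l : Fin L) → Fin (C.layer l).numGates → U (Fin 2 × Fin 2)) × (Fin n → U (Fin 2))

/-- The law of the gates: all gates are independent. -/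
def law (C : RandomCircuit n L) : Measure C.Gates :=
  (Measure.pi fun l => Measure.pi (C.layer l).gateLaw).prod (Measure.pi C.singleLaw)

/-- The output `Φ(ρ)`, where `Φ = 𝒱 ∘ N^{⊗n} ∘ 𝒰_L ∘ ⋯ ∘ N^{⊗n} ∘ 𝒰_1`. -/
def output (C : RandomCircuit n L) (N : QubitMap) (ω : C.Gates) (ρ : Op n) : Op n :=
  tensor (fun i => (ω.2 i).1) *
    Fin.foldl L (fun A l => tensorChannel N
      ((C.layer l).unitary (ω.1 l) * A * ((C.layer l).unitary (ω.1 l)).conjTranspose)) ρ *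
    (tensor fun i => (ω.2 i).1).conjTranspose

/-- `Var_Φ[Tr(H Φ(ρ))]` over the random gates, for `H = ∑_P a_P P`. -/
def costVariance (C : RandomCircuit n L) (N : QubitMap) (ρ : Op n) (a : PauliString n → ℝ) : ℝ :=
  variance (fun ω : C.Gates => expVal (hamiltonian a) (C.output N ω ρ)) C.law

end RandomCircuit

end NoisyCircuit

end

noncomputable section

namespace NoisyCircuit

/-! ### Tensor products of single-qubit operators -/

/-! Everything is read in the Pauli basis, and only the last random layer, its noise and the final
single-qubit gates matter; the earlier layers enter solely through the fact that they produce a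
state. This is why the bounds do not depend on the depth.

Second moments of a 2-design agree with those of Haar measure, so they are unchanged when a gate is
multiplied on the left by a fixed unitary (`IsTwoDesign.integral_expVal_mul_left`). A fixed
single-qubit unitary placed after a covering layer is absorbed by the last gate on its qubit
(`exists_absorbing_gate`); hence the random state after a layer is `LocallyInvariant`. Conjugating
by a Pauli that commutes with one of two strings and anticommutes with the other at some site shows
that expectations of distinct Pauli strings are orthogonal. Conjugating by a Clifford that cycles
`X`, `Y`, `Z` shows that second moments depend only on the support of the string.

Applied to the final gates, orthogonality turns the variance into `∑ a_P ^ 2 * pauliVariance P`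
(`RandomCircuit.costVariance_eq`). Since all `3 ^ |P|` strings with the support of `P` have the same
second moment, and single-qubit rotations act orthogonally on their span, `3 ^ |P| * pauliVariance
P` is the mean sum of squares over this class just after the last noise
(`RandomCircuit.pauliVariance_eq`). The output rotation of the normal form drops out of that sum,
and the input rotation does not disturb orthogonality before the noise. What remains is `∑ T_{QQ'} ^
2 * m_{Q'}`, where `T` is a tensor power of the normal-form matrix, `0 ≤ m ≤ 1`, and `m = 1` at the
identity string. Keeping only the identity column gives `‖t‖ ^ (2|P|)` as a lower bound; replacing
every `m` by `1` gives `(‖t‖ ^ 2 + ‖D‖ ^ 2) ^ |P|` as an upper bound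
(`RandomCircuit.pauliVariance_bounds`).

Finally, positivity of the images of `I ± Q` forces `contractionCoeff t D ≤ 1 - 2/3 * ‖t‖ ^ 2`
(`contractionCoeff_le`), so both bases are controlled by a lower bound on `‖t‖` alone. -/

lemma tensor_mul {n : ℕ} (A B : Fin n → Matrix (Fin 2) (Fin 2) ℂ) :
    tensor A * tensor B = tensor fun i => A i * B i := by
  ext x y
  simp only [tensor, Matrix.mul_apply, Matrix.of_apply, ← Finset.prod_mul_distrib]
  rw [Fintype.prod_sum]

lemma tensor_conjTranspose {n : ℕ} (A : Fin n → Matrix (Fin 2) (Fin 2) ℂ) :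
    (tensor A).conjTranspose = tensor fun i => (A i).conjTranspose := by
  ext x y
  simp [tensor]

lemma tensor_one {n : ℕ} : tensor (fun _ : Fin n => (1 : Matrix (Fin 2) (Fin 2) ℂ)) = 1 := by
  ext x y
  simp only [tensor, Matrix.of_apply, Matrix.one_apply]
  rw [Finset.prod_ite_zero]
  simp [funext_iff]

lemma trace_tensor {n : ℕ} (A : Fin n → Matrix (Fin 2) (Fin 2) ℂ) :
    (tensor A).trace = ∏ i, (A i).trace := by
  simp only [tensor, Matrix.trace, Matrix.diag, Matrix.of_apply]
  rw [Fintype.prod_sum]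

lemma tensor_update {n : ℕ} (A : Fin n → Matrix (Fin 2) (Fin 2) ℂ) (i : Fin n)
    (X : Matrix (Fin 2) (Fin 2) ℂ) (x y : Bits n) :
    tensor (Function.update A i X) x y =
      X (x i) (y i) * ∏ j ∈ Finset.univ.erase i, A j (x j) (y j) := by
  simp only [tensor, Matrix.of_apply]
  rw [← Finset.mul_prod_erase _ _ (Finset.mem_univ i)]
  congr 1
  · simp
  · exact Finset.prod_congr rfl fun j hj => by
      rw [Function.update_of_ne (Finset.ne_of_mem_erase hj)]

/-- A tensor product as a linear function of its factor at `i`. -/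
def tensorAt {n : ℕ} (A : Fin n → Matrix (Fin 2) (Fin 2) ℂ) (i : Fin n) :
    Matrix (Fin 2) (Fin 2) ℂ →ₗ[ℂ] Op n where
  toFun X := tensor (Function.update A i X)
  map_add' X Y := by
    ext x y
    simp [tensor_update, add_mul]
  map_smul' c X := by
    ext x y
    simp [tensor_update, mul_assoc]

/-- The single-qubit operator `w` acting on qubit `i`. -/
def site {n : ℕ} (i : Fin n) (w : Matrix (Fin 2) (Fin 2) ℂ) : Op n :=
  tensor (Function.update (fun _ => 1) i w)

lemma site_mul_tensor {n : ℕ} (i : Fin n) (w : Matrix (Fin 2) (Fin 2) ℂ)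
    (A : Fin n → Matrix (Fin 2) (Fin 2) ℂ) :
    site i w * tensor A = tensor (Function.update A i (w * A i)) := by
  rw [site, tensor_mul]
  congr 1
  ext1 j
  by_cases h : j = i
  · subst h; simp
  · simp [h]

lemma site_conjTranspose {n : ℕ} (i : Fin n) (w : Matrix (Fin 2) (Fin 2) ℂ) :
    (site i w).conjTranspose = site i w.conjTranspose := by
  rw [site, tensor_conjTranspose, site]
  congr 1
  ext1 j
  by_cases h : j = i
  · subst h; simp
  · simp [h]

lemma tensor_mul_site {n : ℕ} (i : Fin n) (w : Matrix (Fin 2) (Fin 2) ℂ)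
    (A : Fin n → Matrix (Fin 2) (Fin 2) ℂ) :
    tensor A * site i w = tensor (Function.update A i (A i * w)) := by
  rw [site, tensor_mul]
  congr 1
  ext1 j
  by_cases h : j = i
  · subst h; simp
  · simp [h]

/-! ### Pauli matrices -/

lemma pauli_zero : pauli 0 = 1 := by
  ext i j; fin_cases i <;> fin_cases j <;> simp [pauli]

lemma pauliOp_zero {n : ℕ} : pauliOp (0 : PauliString n) = 1 := by
  simp only [pauliOp, Pi.zero_apply, pauli_zero, tensor_one]

lemma pauli_conjTranspose (q : Fin 4) : (pauli q).conjTranspose = pauli q := by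
  ext i j; fin_cases q <;> fin_cases i <;> fin_cases j <;> simp [pauli]

lemma pauli_mul_self (q : Fin 4) : pauli q * pauli q = 1 := by
  ext i j; fin_cases q <;> fin_cases i <;> fin_cases j <;>
    simp [pauli, Matrix.mul_apply]

lemma pauliOp_conjTranspose {n : ℕ} (P : PauliString n) :
    (pauliOp P).conjTranspose = pauliOp P := by
  simp [pauliOp, tensor_conjTranspose, pauli_conjTranspose]

lemma pauliOp_mul_self {n : ℕ} (P : PauliString n) : pauliOp P * pauliOp P = 1 := by
  simp [pauliOp, tensor_mul, pauli_mul_self, tensor_one]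

lemma trace_pauli_mul_pauli (p q : Fin 4) :
    (pauli p * pauli q).trace = if p = q then 2 else 0 := by
  fin_cases p <;> fin_cases q <;> simp [pauli, Matrix.trace] <;> norm_num

lemma trace_pauli (q : Fin 4) : (pauli q).trace = if q = 0 then 2 else 0 := by
  fin_cases q <;> simp [pauli, Matrix.trace]; norm_num

lemma pauli_expansion (A : Matrix (Fin 2) (Fin 2) ℂ) :
    A = ∑ q, ((pauli q * A).trace / 2) • pauli q := by
  ext i j
  fin_cases i <;> fin_cases j <;>
    simp [pauli, Matrix.trace, Matrix.mul_apply, Fin.sum_univ_four] <;> ring_nf <;>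
    simp <;> ring

lemma trace_mul_expansion (A B : Matrix (Fin 2) (Fin 2) ℂ) :
    (A * B).trace = ∑ q, (pauli q * A).trace / 2 * (pauli q * B).trace := by
  conv_lhs => rw [pauli_expansion A]
  simp [Finset.sum_mul, Matrix.trace_sum]

/-- Pauli matrices commute or anticommute, and distinct ones are told apart by a third. -/
lemma exists_pauli_separating (p q : Fin 4) (h : p ≠ q) :
    ∃ (s : Fin 4) (e f : ℝ), e * f = -1 ∧
      pauli s * pauli p * pauli s = (e : ℂ) • pauli p ∧
      pauli s * pauli q * pauli s = (f : ℂ) • pauli q := by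
  have key : ∀ s r : Fin 4, pauli s * pauli r * pauli s =
      (((if s = 0 ∨ r = 0 ∨ s = r then 1 else -1 : ℝ)) : ℂ) • pauli r := by
    intro s r
    ext i j
    fin_cases s <;> fin_cases r <;> fin_cases i <;> fin_cases j <;>
      simp [pauli, Matrix.mul_apply]
  -- If one label is trivial, any nontrivial label different from the other one separates them. If
  -- both are nontrivial, `p` commutes with itself and anticommutes with `q`.
  by_cases hp : p = 0
  · refine ⟨if q = 1 then 2 else 1, _, _, ?_, key _ _, key _ _⟩
    subst hp
    fin_cases q <;> simp at h ⊢
  · by_cases hq : q = 0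
    · refine ⟨if p = 1 then 2 else 1, _, _, ?_, key _ _, key _ _⟩
      subst hq
      fin_cases p <;> simp at h ⊢
    · refine ⟨p, _, _, ?_, key _ _, key _ _⟩
      simp [hp, hq, h]

/-- A single-qubit Clifford gate permuting `X`, `Y`, `Z` cyclically. -/
def cyclicClifford : U (Fin 2) :=
  ⟨!![(1 + Complex.I) / 2, (1 + Complex.I) / 2; (Complex.I - 1) / 2, (1 - Complex.I) / 2], by
    rw [Matrix.mem_unitaryGroup_iff]
    ext i j
    fin_cases i <;> fin_cases j <;>
      simp [Matrix.mul_apply, map_ofNat] <;> ring_nf <;> simp <;> norm_num⟩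

lemma cyclicClifford_conj (q : Fin 4) :
    cyclicClifford.1.conjTranspose * pauli q * cyclicClifford.1 =
      pauli (if q = 0 then 0 else if q = 1 then 2 else if q = 2 then 3 else 1) := by
  ext i j
  fin_cases q <;> fin_cases i <;> fin_cases j <;>
    simp [cyclicClifford, pauli, Matrix.mul_apply, map_ofNat] <;> ring_nf <;> simp <;> norm_num

/-! ### Expectation values -/

lemma expVal_add_left {n : ℕ} (H K ρ : Op n) : expVal (H + K) ρ = expVal H ρ + expVal K ρ := by
  simp [expVal, add_mul]

lemma expVal_smul_left {n : ℕ} (c : ℝ) (H ρ : Op n) :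
    expVal ((c : ℂ) • H) ρ = c * expVal H ρ := by
  simp [expVal]

lemma expVal_sum_left {n : ℕ} {ι : Type*} (s : Finset ι) (H : ι → Op n) (ρ : Op n) :
    expVal (∑ i ∈ s, H i) ρ = ∑ i ∈ s, expVal (H i) ρ := by
  simp [expVal, Finset.sum_mul, Matrix.trace_sum]

lemma expVal_hamiltonian {n : ℕ} (a : PauliString n → ℝ) (ρ : Op n) :
    expVal (hamiltonian a) ρ = ∑ P, a P * expVal (pauliOp P) ρ := by
  simp only [hamiltonian, expVal_sum_left, expVal_smul_left]

lemma expVal_conj {n : ℕ} (H W ρ : Op n) :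
    expVal H (W * ρ * W.conjTranspose) = expVal (W.conjTranspose * H * W) ρ := by
  rw [expVal, expVal, ← mul_assoc, Matrix.trace_mul_comm]
  simp only [mul_assoc]

lemma continuous_expVal {n : ℕ} (H : Op n) : Continuous fun ρ : Op n => expVal H ρ := by
  unfold expVal
  fun_prop

/-! ### Transfer matrices in the Pauli basis -/

/-- The tensor product of single-qubit maps. -/
def tensorMap {n : ℕ} (M : Fin n → QubitMap) (A : Op n) : Op n :=
  ∑ x, ∑ y, A x y • tensor fun i => M i (Matrix.single (x i) (y i) 1)

lemma tensorChannel_eq_tensorMap (N : QubitMap) {n : ℕ} (A : Op n) :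
    tensorChannel N A = tensorMap (fun _ => N) A := rfl

/-- Matrix units of the register are products of single-qubit matrix units. Identities linear in `A`
can therefore be checked on product operators, where traces and tensor maps factor over the qubits.
-/
lemma tensor_eq_sum_single {n : ℕ} (A : Op n) :
    A = ∑ x, ∑ y, A x y • tensor fun i => Matrix.single (x i) (y i) (1 : ℂ) := by
  have h : ∀ x y : Bits n,
      (tensor fun i => Matrix.single (x i) (y i) (1 : ℂ)) = Matrix.single x y 1 := by
    intro x y
    ext z w
    simp only [tensor, Matrix.of_apply, Matrix.single_apply, Finset.prod_ite_zero]
    simp [funext_iff, forall_and]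
  conv_lhs => rw [Matrix.matrix_eq_sum_single A]
  simp [h, Matrix.smul_single]

/-- Conjugation by a single-qubit operator. -/
def conjMap (w : Matrix (Fin 2) (Fin 2) ℂ) : QubitMap :=
  (LinearMap.mulRight ℂ w.conjTranspose).comp (LinearMap.mulLeft ℂ w)

lemma conjMap_apply (w A : Matrix (Fin 2) (Fin 2) ℂ) :
    conjMap w A = w * A * w.conjTranspose := by
  simp [conjMap]

lemma tensor_conj_eq_tensorMap {n : ℕ} (w : Fin n → Matrix (Fin 2) (Fin 2) ℂ) (A : Op n) :
    tensor w * A * (tensor w).conjTranspose = tensorMap (fun i => conjMap (w i)) A := by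
  conv_lhs => rw [tensor_eq_sum_single A]
  simp [tensorMap, conjMap_apply, Finset.mul_sum, Finset.sum_mul, tensor_conjTranspose,
    tensor_mul]

/-- `T` is the matrix of the single-qubit map `M` in the Pauli basis. -/
def IsTransfer (M : QubitMap) (T : Fin 4 → Fin 4 → ℝ) : Prop :=
  ∀ q A, (pauli q * M A).trace = ∑ q', (T q q' : ℂ) * (pauli q' * A).trace

/-- On a product operator the trace factors, each factor expands through its own `T i`, and
multiplying out yields a sum over strings: transfer matrices tensor along with the maps. -/
lemma expVal_tensorMap {n : ℕ} {M : Fin n → QubitMap} {T : Fin n → Fin 4 → Fin 4 → ℝ}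
    (h : ∀ i, IsTransfer (M i) (T i)) (Q : PauliString n) (A : Op n) :
    expVal (pauliOp Q) (tensorMap M A) =
      ∑ Q' : PauliString n, (∏ i, T i (Q i) (Q' i)) * expVal (pauliOp Q') A := by
  have key : (pauliOp Q * tensorMap M A).trace =
      ∑ Q' : PauliString n, ((∏ i, T i (Q i) (Q' i) : ℝ) : ℂ) * (pauliOp Q' * A).trace := by
    have e : ∀ Q' : PauliString n, (pauliOp Q' * A).trace = ∑ x, ∑ y, A x y *
        ∏ i, (pauli (Q' i) * Matrix.single (x i) (y i) (1 : ℂ)).trace := by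
      intro Q'
      conv_lhs => rw [tensor_eq_sum_single A]
      simp only [pauliOp, Finset.mul_sum, Matrix.trace_sum, Matrix.mul_smul, tensor_mul,
        Matrix.trace_smul, trace_tensor, smul_eq_mul]
    simp only [e, Finset.mul_sum]
    rw [Finset.sum_comm]
    simp only [pauliOp, tensorMap, Finset.mul_sum, Matrix.trace_sum, Matrix.mul_smul, tensor_mul,
        Matrix.trace_smul, trace_tensor, smul_eq_mul]
    refine Finset.sum_congr rfl fun x _ => ?_
    rw [Finset.sum_comm]
    refine Finset.sum_congr rfl fun y _ => ?_
    simp only [h _ _ _]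
    rw [Fintype.prod_sum, Finset.mul_sum]
    refine Finset.sum_congr rfl fun Q' _ => ?_
    rw [Finset.prod_mul_distrib]
    push_cast
    ring
  -- The coefficients are real, so taking real parts commutes with the expansion.
  have := congrArg Complex.re key
  simpa [expVal, ← Complex.ofReal_prod] using this

/-! ### Rotations in the Pauli basis -/

lemma trace_hermitian_mul_im {d : Type*} [Fintype d] {A B : Matrix d d ℂ}
    (hA : A.conjTranspose = A) (hB : B.conjTranspose = B) : (A * B).trace.im = 0 := by
  have h : star (A * B).trace = (A * B).trace := by
    rw [← Matrix.trace_conjTranspose, Matrix.conjTranspose_mul, hA, hB, Matrix.trace_mul_comm]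
  exact Complex.conj_eq_iff_im.mp h

lemma unitary_conjTranspose_mul {d : Type} [Fintype d] [DecidableEq d] (u : U d) :
    u.1.conjTranspose * u.1 = 1 := by
  have := (Matrix.mem_unitaryGroup_iff').mp u.2
  simpa [Matrix.star_eq_conjTranspose] using this

lemma unitary_mul_conjTranspose {d : Type} [Fintype d] [DecidableEq d] (u : U d) :
    u.1 * u.1.conjTranspose = 1 := by
  have := (Matrix.mem_unitaryGroup_iff).mp u.2
  simpa [Matrix.star_eq_conjTranspose] using this

/-- The transfer matrix of conjugation by `u`. -/
def rotation (u : U (Fin 2)) (q q' : Fin 4) : ℝ :=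
  (pauli q * (u.1 * pauli q' * u.1.conjTranspose)).trace.re / 2

/-- The trace of a product of two Hermitian matrices is real, so the real part in the definition
loses nothing. -/
lemma rotation_coe (u : U (Fin 2)) (q q' : Fin 4) :
    (rotation u q q' : ℂ) = (pauli q * (u.1 * pauli q' * u.1.conjTranspose)).trace / 2 := by
  have h := trace_hermitian_mul_im (pauli_conjTranspose q)
    (B := u.1 * pauli q' * u.1.conjTranspose)
    (by simp [Matrix.conjTranspose_mul, pauli_conjTranspose, mul_assoc])
  apply Complex.ext
  · simp [rotation]
  · simp [h]

lemma isTransfer_rotation (u : U (Fin 2)) : IsTransfer (conjMap u.1) (rotation u) := by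
  intro q A
  rw [conjMap_apply]
  conv_lhs => rw [pauli_expansion A]
  simp only [Finset.mul_sum, Finset.sum_mul, Matrix.mul_smul, Matrix.smul_mul, Matrix.trace_sum,
    Matrix.trace_smul, smul_eq_mul, rotation_coe]
  exact Finset.sum_congr rfl fun _ _ => by ring

lemma rotation_zero_left (u : U (Fin 2)) (q : Fin 4) :
    rotation u 0 q = if q = 0 then 1 else 0 := by
  have : (u.1 * pauli q * u.1.conjTranspose).trace = (pauli q).trace := by
    rw [Matrix.trace_mul_comm, ← mul_assoc, unitary_conjTranspose_mul, one_mul]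
  rw [rotation, pauli_zero, one_mul, this, trace_pauli]
  split_ifs <;> simp

lemma rotation_zero_right (u : U (Fin 2)) (q : Fin 4) :
    rotation u q 0 = if q = 0 then 1 else 0 := by
  rw [rotation, pauli_zero, mul_one, unitary_mul_conjTranspose, mul_one, trace_pauli]
  split_ifs <;> simp

/-- Conjugation by a unitary preserves the Hilbert–Schmidt product, for which the Pauli matrices are
orthogonal of equal norm. -/
lemma sum_rotation_mul_rotation (u : U (Fin 2)) (p q : Fin 4) :
    ∑ r, rotation u r p * rotation u r q = if p = q then 1 else 0 := by
  have h := trace_mul_expansion (u.1 * pauli p * u.1.conjTranspose)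
    (u.1 * pauli q * u.1.conjTranspose)
  have e : u.1 * pauli p * u.1.conjTranspose * (u.1 * pauli q * u.1.conjTranspose) =
      u.1 * (pauli p * pauli q) * u.1.conjTranspose := by
    calc _ = u.1 * pauli p * (u.1.conjTranspose * u.1) * pauli q * u.1.conjTranspose := by
          simp only [mul_assoc]
      _ = _ := by rw [unitary_conjTranspose_mul]; simp only [mul_assoc, one_mul]
  rw [e, Matrix.trace_mul_comm, ← mul_assoc, unitary_conjTranspose_mul, one_mul,
    trace_pauli_mul_pauli] at h
  have h2 : ((∑ r, rotation u r p * rotation u r q : ℝ) : ℂ) =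
      (((if p = q then 1 else 0 : ℝ)) : ℂ) := by
    push_cast
    simp only [rotation_coe]
    have : ∀ r, (pauli r * (u.1 * pauli p * u.1.conjTranspose)).trace / 2 *
        ((pauli r * (u.1 * pauli q * u.1.conjTranspose)).trace / 2) =
        ((pauli r * (u.1 * pauli p * u.1.conjTranspose)).trace / 2 *
        (pauli r * (u.1 * pauli q * u.1.conjTranspose)).trace) / 2 := fun r => by ring
    simp only [this]
    rw [← Finset.sum_div, ← h]
    split_ifs <;> simp
  exact_mod_cast h2

/-! ### Strings with a given support -/

/-- The Pauli labels that are trivial exactly when `p` is. -/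
def labelClass (p : Fin 4) : Finset (Fin 4) := Finset.univ.filter fun q => q = 0 ↔ p = 0

/-- The Pauli strings with the support of `P`. -/
def supportClass {n : ℕ} (P : PauliString n) : Finset (PauliString n) :=
  Fintype.piFinset fun i => labelClass (P i)

lemma mem_supportClass {n : ℕ} {P Q : PauliString n} :
    Q ∈ supportClass P ↔ ∀ i, Q i = 0 ↔ P i = 0 := by
  simp [supportClass, labelClass]

lemma labelClass_of_ne_zero {p : Fin 4} (h : p ≠ 0) : labelClass p = {1, 2, 3} := by
  ext q
  fin_cases q <;> simp [labelClass, h]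

lemma labelClass_zero : labelClass 0 = {0} := by
  ext q
  simp [labelClass]

lemma prod_ite_support {n : ℕ} (P : PauliString n) (x : ℝ) :
    (∏ i, if P i = 0 then 1 else x) = x ^ weight P := by
  rw [Finset.prod_ite]
  simp [weight]

lemma card_supportClass {n : ℕ} (P : PauliString n) :
    ((supportClass P).card : ℝ) = 3 ^ weight P := by
  rw [supportClass, Fintype.card_piFinset, ← prod_ite_support]
  push_cast
  refine Finset.prod_congr rfl fun i _ => ?_
  split_ifs with h
  · simp [h, labelClass_zero]
  · simp [labelClass_of_ne_zero h]

/-- A rotation is block diagonal, `1` on the identity and an orthogonal `3 × 3` block on `X`, `Y`,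
`Z`; the columns are thus orthonormal within each block separately. -/
lemma sum_labelClass_rotation (u : U (Fin 2)) (r p q : Fin 4) :
    ∑ s ∈ labelClass r, rotation u s p * rotation u s q =
      if p = q ∧ (p = 0 ↔ r = 0) then 1 else 0 := by
  have h := sum_rotation_mul_rotation u p q
  by_cases hr : r = 0
  · subst hr
    rw [labelClass_zero, Finset.sum_singleton, rotation_zero_left, rotation_zero_left]
    by_cases hp : p = 0 <;> by_cases hq : q = 0 <;> simp [hp, hq]
    · intro h'; exact hq h'.symm
  · rw [labelClass_of_ne_zero hr]
    rw [Fin.sum_univ_four, rotation_zero_left, rotation_zero_left] at h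
    rw [Finset.sum_insert (by decide), Finset.sum_insert (by decide), Finset.sum_singleton]
    by_cases hp : p = 0 <;> by_cases hq : q = 0 <;> by_cases hpq : p = q <;>
      simp_all [rotation_zero_right] <;> linarith

/-- Strings of a fixed support span a space on which local rotations act by a tensor product of
orthogonal blocks, so the sum of squared coordinates is invariant. -/
lemma sum_supportClass_tensor_conj {n : ℕ} (u : Fin n → U (Fin 2)) (P : PauliString n) (A : Op n) :
    ∑ Q ∈ supportClass P,
        expVal (pauliOp Q) (tensor (fun i => (u i).1) * A *
          (tensor fun i => (u i).1).conjTranspose) ^ 2 =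
      ∑ Q ∈ supportClass P, expVal (pauliOp Q) A ^ 2 := by
  simp only [tensor_conj_eq_tensorMap, expVal_tensorMap fun i => isTransfer_rotation (u i)]
  have h : ∀ R R' : PauliString n,
      ∑ Q ∈ supportClass P,
        (∏ i, rotation (u i) (Q i) (R i)) * (∏ i, rotation (u i) (Q i) (R' i)) =
      if R = R' ∧ R ∈ supportClass P then 1 else 0 := by
    intro R R'
    simp only [← Finset.prod_mul_distrib]
    rw [supportClass, ← Finset.prod_univ_sum (fun i => labelClass (P i))
      (fun i s => rotation (u i) s (R i) * rotation (u i) s (R' i))]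
    simp only [sum_labelClass_rotation]
    rw [Finset.prod_ite_zero]
    simp [funext_iff, forall_and, labelClass]
  calc _ = ∑ R : PauliString n, ∑ R' : PauliString n, (∑ Q ∈ supportClass P,
        (∏ i, rotation (u i) (Q i) (R i)) * (∏ i, rotation (u i) (Q i) (R' i))) *
          (expVal (pauliOp R) A * expVal (pauliOp R') A) := by
        simp only [sq, Finset.sum_mul_sum]
        rw [Finset.sum_comm]
        refine Finset.sum_congr rfl fun R _ => ?_
        rw [Finset.sum_comm]
        refine Finset.sum_congr rfl fun R' _ => ?_
        rw [Finset.sum_mul]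
        exact Finset.sum_congr rfl fun Q _ => by ring
    _ = _ := by
        simp only [h]
        rw [← Finset.sum_filter_add_sum_filter_not Finset.univ (fun R => R ∈ supportClass P)]
        rw [Finset.sum_eq_zero (s := Finset.univ.filter fun R => ¬ R ∈ supportClass P)]
        · simp only [Finset.filter_mem_eq_inter, Finset.univ_inter, add_zero]
          refine Finset.sum_congr rfl fun R hR => ?_
          simp [hR, sq]
        · intro R hR
          simp only [Finset.mem_filter] at hR
          simp [hR.2]

/-! ### The normal form -/

/-- The Pauli-basis matrix of the normal form with parameters `t`, `D`. -/
def normalTransfer (t D : EuclideanSpace ℝ (Fin 3)) : Fin 4 → Fin 4 → ℝ :=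
  ![![1, 0, 0, 0], ![t 0, D 0, 0, 0], ![t 1, 0, D 1, 0], ![t 2, 0, 0, D 2]]

lemma isTransfer_normalTransfer {N' : QubitMap} {t D : EuclideanSpace ℝ (Fin 3)}
    (h0 : N' (pauli 0) = pauli 0 + ∑ k : Fin 3, (t k : ℂ) • pauli k.succ)
    (hk : ∀ k : Fin 3, N' (pauli k.succ) = (D k : ℂ) • pauli k.succ) :
    IsTransfer N' (normalTransfer t D) := by
  intro q A
  have h1 := hk 0
  have h2 := hk 1
  have h3 := hk 2
  simp only [Fin.sum_univ_three] at h0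
  simp only [Fin.succ_zero_eq_one, Fin.succ_one_eq_two, show (2 : Fin 3).succ = 3 from rfl]
    at h0 h1 h2 h3
  conv_lhs => rw [pauli_expansion A]
  simp only [Fin.sum_univ_four, map_add, map_smul, h0, h1, h2, h3, mul_add, Matrix.mul_smul,
    Matrix.trace_add, Matrix.trace_smul, trace_pauli_mul_pauli]
  fin_cases q <;> simp [normalTransfer] <;> ring

lemma sum_labelClass_normalTransfer_zero (t D : EuclideanSpace ℝ (Fin 3)) (p : Fin 4) :
    ∑ q ∈ labelClass p, normalTransfer t D q 0 ^ 2 = if p = 0 then 1 else ‖t‖ ^ 2 := by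
  split_ifs with h
  · simp [h, labelClass_zero, normalTransfer]
  · rw [labelClass_of_ne_zero h, EuclideanSpace.norm_sq_eq, Fin.sum_univ_three]
    simp [normalTransfer, add_assoc]

lemma sum_labelClass_normalTransfer (t D : EuclideanSpace ℝ (Fin 3)) (p : Fin 4) :
    ∑ q ∈ labelClass p, ∑ q', normalTransfer t D q q' ^ 2 =
      if p = 0 then 1 else ‖t‖ ^ 2 + ‖D‖ ^ 2 := by
  split_ifs with h
  · simp [h, labelClass_zero, normalTransfer, Fin.sum_univ_four]
  · rw [labelClass_of_ne_zero h, EuclideanSpace.norm_sq_eq, EuclideanSpace.norm_sq_eq,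
      Fin.sum_univ_three, Fin.sum_univ_three]
    simp [normalTransfer, Fin.sum_univ_four]
    ring

/-! ### Kraus operators and positivity -/

/-- Choi's argument: the image of the unnormalized maximally entangled vector `e` is positive
semidefinite, and the vectors of a rank-one decomposition, reshaped as matrices, are Kraus
operators. -/
lemma IsChannel.exists_kraus {N : QubitMap} (hN : IsChannel N) :
    ∃ (m : ℕ) (K : Fin m → Matrix (Fin 2) (Fin 2) ℂ),
      ∀ A, N A = ∑ r, K r * A * (K r).conjTranspose := by
  let e : Fin 2 × Fin 2 → ℂ := fun p => if p.1 = p.2 then 1 else 0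
  have h := hN.completelyPositive 2 _ (Matrix.posSemidef_vecMulVec_self_star e)
  obtain ⟨m, v, hv⟩ := Matrix.posSemidef_iff_eq_sum_vecMulVec.mp h
  refine ⟨m, fun r => Matrix.of fun p a => v r (p, a), fun A => ?_⟩
  have hs : ∀ a b p q, N (Matrix.single a b 1) p q = ∑ r, v r (p, a) * star (v r (q, b)) := by
    intro a b p q
    have := congrFun (congrFun hv (p, a)) (q, b)
    simp only [ampliation, Matrix.of_apply, Matrix.sum_apply, Matrix.vecMulVec_apply,
      Pi.star_apply] at this
    rw [← this]
    have hab : Matrix.single a b (1 : ℂ) = Matrix.of fun x y => e (x, a) * star (e (y, b)) := by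
      ext x y
      simp only [e, Matrix.single_apply, Matrix.of_apply, @eq_comm _ a, @eq_comm _ b]
      by_cases h1 : x = a <;> by_cases h2 : y = b <;> simp [h1, h2]
    rw [hab]
  ext p q
  conv_lhs => rw [Matrix.matrix_eq_sum_single A]
  have hA : ∀ a b, Matrix.single a b (A a b) = A a b • Matrix.single a b (1 : ℂ) := by
    intro a b; simp [Matrix.smul_single]
  simp only [hA, map_sum, map_smul, Matrix.sum_apply, Matrix.smul_apply, hs, smul_eq_mul,
    Matrix.mul_apply, Matrix.conjTranspose_apply, Matrix.of_apply]
  simp only [Fin.sum_univ_two, Finset.mul_sum, ← Finset.sum_add_distrib]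
  exact Finset.sum_congr rfl fun r _ => by ring

lemma tensorChannel_kraus {N : QubitMap} {m : ℕ} {K : Fin m → Matrix (Fin 2) (Fin 2) ℂ}
    (h : ∀ A, N A = ∑ r, K r * A * (K r).conjTranspose) {n : ℕ} (A : Op n) :
    tensorChannel N A = ∑ r : Fin n → Fin m, (tensor fun i => K (r i)) * A *
      (tensor fun i => K (r i)).conjTranspose := by
  have hs : ∀ x y : Bits n, (tensor fun i => N (Matrix.single (x i) (y i) 1)) =
      ∑ r : Fin n → Fin m, tensor fun i => conjMap (K (r i)) (Matrix.single (x i) (y i) 1) := by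
    intro x y
    ext p q
    simp only [tensor, Matrix.of_apply, Matrix.sum_apply, h, conjMap_apply]
    rw [Fintype.prod_sum]
  simp only [tensor_conj_eq_tensorMap, tensorChannel, tensorMap, hs, Finset.smul_sum]
  rw [Finset.sum_comm]
  conv_rhs => rw [Finset.sum_comm]
  rw [Finset.sum_comm]
  refine Finset.sum_congr rfl fun x _ => ?_
  rw [Finset.sum_comm]

/-- Tensor products of Kraus operators are Kraus operators of the tensor power, which gives
positivity; the trace is preserved factor by factor. -/
lemma IsChannel.isState_tensorChannel {N : QubitMap} (hN : IsChannel N) {n : ℕ} {ρ : Op n}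
    (hρ : IsState ρ) : IsState (tensorChannel N ρ) := by
  obtain ⟨m, K, hK⟩ := hN.exists_kraus
  constructor
  · rw [tensorChannel_kraus hK]
    exact Matrix.posSemidef_sum _ fun r _ => hρ.posSemidef.mul_mul_conjTranspose_same _
  · rw [← hρ.trace_eq_one, tensorChannel]
    conv_rhs => rw [tensor_eq_sum_single ρ]
    simp [Matrix.trace_sum, trace_tensor, hN.tracePreserving]

lemma IsState.conj {n : ℕ} {ρ : Op n} (hρ : IsState ρ) {W : Op n} (hW : W.conjTranspose * W = 1) :
    IsState (W * ρ * W.conjTranspose) := by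
  refine ⟨hρ.posSemidef.mul_mul_conjTranspose_same _, ?_⟩
  rw [Matrix.trace_mul_comm, ← mul_assoc, hW, one_mul, hρ.trace_eq_one]

lemma IsState.expVal_one {n : ℕ} {ρ : Op n} (hρ : IsState ρ) : expVal 1 ρ = 1 := by
  simp [expVal, hρ.trace_eq_one]

lemma IsState.expVal_nonneg_of_sq {n : ℕ} {ρ : Op n} (hρ : IsState ρ) (S : Op n)
    (hS : S.conjTranspose = S) : 0 ≤ expVal (S * S) ρ := by
  have h := (hρ.posSemidef.mul_mul_conjTranspose_same S).trace_nonneg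
  rw [Matrix.trace_mul_comm, ← mul_assoc, hS] at h
  exact (Complex.nonneg_iff.mp h).1

/-- Since `S * S = 1`, the squares of `1 ± S` are `2 (1 ± S)`, and squares of Hermitian operators
have nonnegative expectation. -/
lemma IsState.expVal_sq_le_one {n : ℕ} {ρ : Op n} (hρ : IsState ρ) (S : Op n)
    (hS : S.conjTranspose = S) (hSS : S * S = 1) : expVal S ρ ^ 2 ≤ 1 := by
  have h1 := hρ.expVal_nonneg_of_sq (1 + S) (by simp [hS])
  have h2 := hρ.expVal_nonneg_of_sq (1 + ((-1 : ℝ) : ℂ) • S) (by simp [hS])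
  have e1 : (1 + S) * (1 + S) = ((2 : ℝ) : ℂ) • (1 : Op n) + ((2 : ℝ) : ℂ) • S := by
    rw [add_mul, mul_add, mul_add, hSS]
    push_cast
    simp only [one_mul, mul_one]
    module
  have e2 : (1 + ((-1 : ℝ) : ℂ) • S) * (1 + ((-1 : ℝ) : ℂ) • S) =
      ((2 : ℝ) : ℂ) • (1 : Op n) + ((-2 : ℝ) : ℂ) • S := by
    simp only [add_mul, mul_add, Matrix.smul_mul, Matrix.mul_smul, hSS, one_mul, mul_one]
    push_cast
    module
  rw [e1, expVal_add_left, expVal_smul_left, expVal_smul_left, hρ.expVal_one] at h1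
  rw [e2, expVal_add_left, expVal_smul_left, expVal_smul_left, hρ.expVal_one] at h2
  nlinarith

lemma IsState.expVal_pauliOp_sq_le_one {n : ℕ} {ρ : Op n} (hρ : IsState ρ) (P : PauliString n) :
    expVal (pauliOp P) ρ ^ 2 ≤ 1 :=
  hρ.expVal_sq_le_one _ (pauliOp_conjTranspose P) (pauliOp_mul_self P)

/-! ### The contraction coefficient -/

lemma det_pauli_combination (r : ℝ) (x : Fin 3 → ℝ) :
    ((r : ℂ) • pauli 0 + ∑ k : Fin 3, (x k : ℂ) • pauli k.succ).det =
      ((r ^ 2 - ∑ k, x k ^ 2 : ℝ) : ℂ) := by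
  simp [Matrix.det_fin_two, Fin.sum_univ_three, pauli]
  ring_nf
  simp
  ring

lemma posSemidef_one_add_pauli (e : ℝ) (he : e ^ 2 = 1) (q : Fin 4) :
    (pauli 0 + (e : ℂ) • pauli q).PosSemidef := by
  have h : pauli 0 + (e : ℂ) • pauli q =
      (2⁻¹ : ℂ) • ((pauli 0 + (e : ℂ) • pauli q) * (pauli 0 + (e : ℂ) • pauli q).conjTranspose) := by
    have he' : (e : ℂ) * e = 1 := by
      rw [← Complex.ofReal_mul, ← sq, he, Complex.ofReal_one]
    simp only [Matrix.conjTranspose_add, Matrix.conjTranspose_smul, pauli_conjTranspose,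
      pauli_zero, Matrix.conjTranspose_one, add_mul, mul_add, one_mul, mul_one, Matrix.smul_mul, Matrix.mul_smul,
      pauli_mul_self, smul_smul, Complex.star_def, Complex.conj_ofReal, he', smul_add]
    module
  rw [h]
  exact (Matrix.posSemidef_self_mul_conjTranspose _).smul (by norm_num [Complex.nonneg_iff])

/-- The pure states along the axis `j` are sent to Bloch vectors `t ± D_j e_j`, which must lie in
the unit ball. Averaging the two signs gives `‖t‖ ^ 2 + D_j ^ 2 ≤ 1`, and summing over `j` gives
`3‖t‖ ^ 2 + ‖D‖ ^ 2 ≤ 3`. -/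
lemma contractionCoeff_le {N : QubitMap} {t D : EuclideanSpace ℝ (Fin 3)} (hN : IsChannel N)
    (h : HasNormalForm N t D) : contractionCoeff t D ≤ 1 - 2 / 3 * ‖t‖ ^ 2 := by
  obtain ⟨m, K, hK⟩ := hN.exists_kraus
  have hpos : ∀ A : Matrix (Fin 2) (Fin 2) ℂ, A.PosSemidef → (N A).PosSemidef := by
    intro A hA
    rw [hK]
    exact Matrix.posSemidef_sum _ fun r _ => hA.mul_mul_conjTranspose_same _
  obtain ⟨u, v, N', h0, hk, hconj⟩ := h
  have hu := unitary_conjTranspose_mul u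
  have hv := unitary_conjTranspose_mul v
  have hpos' : ∀ A : Matrix (Fin 2) (Fin 2) ℂ, A.PosSemidef → (N' A).PosSemidef := by
    intro A hA
    have h1 := (hpos _ (hA.mul_mul_conjTranspose_same v.1)).conjTranspose_mul_mul_same u.1
    rw [hconj] at h1
    have e1 : v.1.conjTranspose * (v.1 * A * v.1.conjTranspose) * v.1 = A := by
      calc _ = (v.1.conjTranspose * v.1) * A * (v.1.conjTranspose * v.1) := by
            simp only [mul_assoc]
        _ = A := by rw [hv, one_mul, mul_one]
    rw [e1] at h1
    have e2 : u.1.conjTranspose * (u.1 * N' A * u.1.conjTranspose) * u.1 = N' A := by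
      calc _ = (u.1.conjTranspose * u.1) * N' A * (u.1.conjTranspose * u.1) := by
            simp only [mul_assoc]
        _ = N' A := by rw [hu, one_mul, mul_one]
    rwa [e2] at h1
  -- A positive semidefinite matrix has nonnegative determinant, here one minus the squared length
  -- of the Bloch vector.
  have key : ∀ (e : ℝ), e ^ 2 = 1 → ∀ j : Fin 3,
      ∑ k, (t k + if k = j then e * D k else 0) ^ 2 ≤ 1 := by
    intro e he j
    have h1 := (hpos' _ (posSemidef_one_add_pauli e he j.succ)).det_nonneg
    have h2 : N' (pauli 0 + (e : ℂ) • pauli j.succ) = ((1 : ℝ) : ℂ) • pauli 0 +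
        ∑ k : Fin 3, ((t k + if k = j then e * D k else 0 : ℝ) : ℂ) • pauli k.succ := by
      rw [map_add, map_smul, h0, hk]
      push_cast
      simp only [add_smul, Finset.sum_add_distrib, one_smul, add_assoc]
      congr 2
      rw [Finset.sum_eq_single j]
      · simp only [if_true, smul_smul, Complex.ofReal_mul]
      · intro k _ hkj; simp [hkj]
      · simp
    rw [h2, det_pauli_combination] at h1
    have := (Complex.nonneg_iff.mp h1).1
    simp only [Complex.ofReal_re] at this
    linarith
  have a0 := key 1 (by norm_num) 0
  have a1 := key 1 (by norm_num) 1
  have a2 := key 1 (by norm_num) 2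
  have b0 := key (-1) (by norm_num) 0
  have b1 := key (-1) (by norm_num) 1
  have b2 := key (-1) (by norm_num) 2
  rw [contractionCoeff, EuclideanSpace.norm_sq_eq, EuclideanSpace.norm_sq_eq]
  simp [Fin.sum_univ_three] at *
  linarith

/-! ### Second moments of 2-designs -/

/-- Second countability makes the product σ-algebra on tuples of gates the Borel one, so continuous
functions of all gates are measurable; compactness then makes them integrable. -/
instance instSecondCountableTopologyU (d : Type) [Fintype d] [DecidableEq d] :
    SecondCountableTopology (U d) :=
  haveI : SecondCountableTopology (Matrix d d ℂ) :=
    inferInstanceAs (SecondCountableTopology (d → d → ℂ))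
  TopologicalSpace.Subtype.secondCountableTopology _

instance instIsProbabilityMeasureHaar (d : Type) [Fintype d] [DecidableEq d] :
    IsProbabilityMeasure (haar d) :=
  ⟨by simpa [haar] using
    Measure.haarMeasure_self (K₀ := (⊤ : TopologicalSpace.PositiveCompacts (U d)))⟩

instance instIsMulLeftInvariantHaar (d : Type) [Fintype d] [DecidableEq d] :
    (haar d).IsMulLeftInvariant := by
  unfold haar
  infer_instance

lemma integrable_of_continuous {X E : Type*} [TopologicalSpace X] [CompactSpace X]
    [MeasurableSpace X] [OpensMeasurableSpace X] [NormedAddCommGroup E] {μ : Measure X}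
    [IsFiniteMeasure μ] {f : X → E} (hf : Continuous f) : Integrable f μ :=
  hf.integrable_of_hasCompactSupport (HasCompactSupport.of_compactSpace f)

lemma continuous_entry {d : Type} [Fintype d] [DecidableEq d] (a b : d) :
    Continuous fun V : U d => V.1 a b :=
  (continuous_apply_apply a b).comp continuous_subtype_val

/-- The four-fold products of gate entries are integrated alike by all 2-designs. -/
lemma IsTwoDesign.integral_entries {d : Type} [Fintype d] [DecidableEq d] {ν : Measure (U d)}
    (hν : IsTwoDesign ν) (a b a' b' e f e' f' : d) :
    ∫ V : U d, V.1 a b * V.1 a' b' * (star (V.1 e f) * star (V.1 e' f')) ∂ν =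
      ∫ V : U d, V.1 a b * V.1 a' b' * (star (V.1 e f) * star (V.1 e' f')) ∂(haar d) := by
  -- Twirling a matrix unit isolates a single monomial in the entries of `V` and their conjugates.
  have h := congrFun (congrFun (hν.twirl_eq (Matrix.single (b, b') (f, f') 1)) (a, a')) (e, e')
  have key : ∀ V : U d, ((V.1 ⊗ₖ V.1) * Matrix.single (b, b') (f, f') (1 : ℂ) *
      (V.1 ⊗ₖ V.1).conjTranspose) (a, a') (e, e') =
      V.1 a b * V.1 a' b' * (star (V.1 e f) * star (V.1 e' f')) := by
    intro V
    rw [Matrix.mul_apply, Finset.sum_eq_single (f, f')]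
    · rw [Matrix.mul_apply, Finset.sum_eq_single (b, b')]
      · simp
      · intro p _ hp
        rw [Matrix.single_apply_of_ne]
        · simp
        · simp [Ne.symm hp]
      · simp
    · intro p _ hp
      rw [Matrix.mul_apply, Finset.sum_eq_zero]
      · simp
      · intro q _
        rw [Matrix.single_apply_of_ne]
        · simp
        · simp [Ne.symm hp]
    · simp
  simpa only [twirl, Matrix.of_apply, key] using h

/-- The real-valued function `V ↦ Tr(R φ(V) A φ(V)†)` as a form in the entries of `V` and their
conjugates. -/
lemma exists_entry_form {d : Type} [Fintype d] [DecidableEq d] {n : ℕ}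
    (φ : Matrix d d ℂ →ₗ[ℂ] Op n) (A R : Op n) :
    ∃ r : (d × d) → (d × d) → ℂ, ∀ V : Matrix d d ℂ,
      (expVal R (φ V * A * (φ V).conjTranspose) : ℂ) =
        ∑ p, ∑ q, r p q * (V p.1 p.2 * star (V q.1 q.2)) := by
  let s : (d × d) → (d × d) → ℂ := fun p q =>
    (R * (φ (Matrix.single p.1 p.2 1) * A * (φ (Matrix.single q.1 q.2 1)).conjTranspose)).trace
  have hφ : ∀ V : Matrix d d ℂ, φ V = ∑ p : d × d, V p.1 p.2 • φ (Matrix.single p.1 p.2 1) := by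
    intro V
    conv_lhs => rw [Matrix.matrix_eq_sum_single V]
    rw [Fintype.sum_prod_type]
    simp only [map_sum, ← map_smul, Matrix.smul_single, smul_eq_mul, mul_one]
  have hs : ∀ V : Matrix d d ℂ, (R * (φ V * A * (φ V).conjTranspose)).trace =
      ∑ p, ∑ q, s p q * (V p.1 p.2 * star (V q.1 q.2)) := by
    intro V
    rw [hφ V]
    simp only [Matrix.conjTranspose_sum, Matrix.conjTranspose_smul, Finset.sum_mul, Finset.mul_sum,
      Matrix.smul_mul, Matrix.mul_smul, Matrix.trace_sum, Matrix.trace_smul, smul_eq_mul, s]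
    rw [Finset.sum_comm]
    exact Finset.sum_congr rfl fun p _ => Finset.sum_congr rfl fun q _ => by ring
  -- `expVal` is a real part, so the coefficient form is averaged with its conjugate transpose.
  refine ⟨fun p q => (s p q + star (s q p)) / 2, fun V => ?_⟩
  rw [expVal, Complex.re_eq_add_conj, hs]
  simp only [map_sum, map_mul, Complex.star_def, Complex.conj_conj]
  rw [Finset.sum_comm (f := fun p q => (starRingEnd ℂ) (s p q) * _)]
  simp only [← Finset.sum_add_distrib, Finset.sum_div]
  exact Finset.sum_congr rfl fun p _ => Finset.sum_congr rfl fun q _ => by ring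

/-- The integrand has degree two in the entries of `V` and degree two in their conjugates. An
arbitrary linear `φ` allows for a gate sitting anywhere inside a larger circuit. -/
lemma IsTwoDesign.integral_expVal_mul_eq_haar {d : Type} [Fintype d] [DecidableEq d] {n : ℕ}
    {ν : Measure (U d)} (hν : IsTwoDesign ν) (φ : Matrix d d ℂ →ₗ[ℂ] Op n) (A R R' : Op n) :
    ∫ V : U d, expVal R (φ V.1 * A * (φ V.1).conjTranspose) *
        expVal R' (φ V.1 * A * (φ V.1).conjTranspose) ∂ν =
      ∫ V : U d, expVal R (φ V.1 * A * (φ V.1).conjTranspose) *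
        expVal R' (φ V.1 * A * (φ V.1).conjTranspose) ∂(haar d) := by
  obtain ⟨r, hr⟩ := exists_entry_form φ A R
  obtain ⟨r', hr'⟩ := exists_entry_form φ A R'
  have hν' := hν.isProbabilityMeasure
  have h : ∀ μ : Measure (U d), IsProbabilityMeasure μ →
      ((∫ V : U d, expVal R (φ V.1 * A * (φ V.1).conjTranspose) *
        expVal R' (φ V.1 * A * (φ V.1).conjTranspose) ∂μ : ℝ) : ℂ) =
      ∑ p, ∑ q, ∑ p', ∑ q', r p q * r' p' q' *
        ∫ V : U d, V.1 p.1 p.2 * V.1 p'.1 p'.2 * (star (V.1 q.1 q.2) * star (V.1 q'.1 q'.2)) ∂μ := by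
    intro μ hμ
    have hint : ∀ p q p' q' : d × d, Integrable (fun V : U d => r p q * r' p' q' *
        (V.1 p.1 p.2 * V.1 p'.1 p'.2 * (star (V.1 q.1 q.2) * star (V.1 q'.1 q'.2)))) μ := by
      intro p q p' q'
      refine integrable_of_continuous ?_
      exact continuous_const.mul (((continuous_entry _ _).mul (continuous_entry _ _)).mul
        ((continuous_entry _ _).star.mul (continuous_entry _ _).star))
    have hexp : ∀ V : U d, ((expVal R (φ V.1 * A * (φ V.1).conjTranspose) *
        expVal R' (φ V.1 * A * (φ V.1).conjTranspose) : ℝ) : ℂ) =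
        ∑ p, ∑ q, ∑ p', ∑ q', r p q * r' p' q' *
          (V.1 p.1 p.2 * V.1 p'.1 p'.2 * (star (V.1 q.1 q.2) * star (V.1 q'.1 q'.2))) := by
      intro V
      rw [Complex.ofReal_mul, hr, hr', Finset.sum_mul]
      refine Finset.sum_congr rfl fun p _ => ?_
      rw [Finset.sum_mul]
      refine Finset.sum_congr rfl fun q _ => ?_
      rw [Finset.mul_sum]
      refine Finset.sum_congr rfl fun p' _ => ?_
      rw [Finset.mul_sum]
      exact Finset.sum_congr rfl fun q' _ => by ring
    rw [← integral_complex_ofReal]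
    simp only [hexp, ← integral_const_mul]
    rw [integral_finsetSum _ fun p _ => integrable_finsetSum _ fun q _ =>
      integrable_finsetSum _ fun p' _ => integrable_finsetSum _ fun q' _ => hint p q p' q']
    refine Finset.sum_congr rfl fun p _ => ?_
    rw [integral_finsetSum _ fun q _ =>
      integrable_finsetSum _ fun p' _ => integrable_finsetSum _ fun q' _ => hint p q p' q']
    refine Finset.sum_congr rfl fun q _ => ?_
    rw [integral_finsetSum _ fun p' _ => integrable_finsetSum _ fun q' _ => hint p q p' q']
    refine Finset.sum_congr rfl fun p' _ => ?_
    rw [integral_finsetSum _ fun q' _ => hint p q p' q']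
  have h2 := h ν hν'
  simp only [hν.integral_entries] at h2
  rw [← h (haar d) inferInstance] at h2
  exact_mod_cast h2

/-- Left translation followed by `φ` is again linear in `V`, so both sides may be computed with Haar
measure, which is left invariant. -/
lemma IsTwoDesign.integral_expVal_mul_left {d : Type} [Fintype d] [DecidableEq d] {n : ℕ}
    {ν : Measure (U d)} (hν : IsTwoDesign ν) (φ : Matrix d d ℂ →ₗ[ℂ] Op n) (A R R' : Op n)
    (w : U d) :
    ∫ V : U d, expVal R (φ (w * V).1 * A * (φ (w * V).1).conjTranspose) *
        expVal R' (φ (w * V).1 * A * (φ (w * V).1).conjTranspose) ∂ν =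
      ∫ V : U d, expVal R (φ V.1 * A * (φ V.1).conjTranspose) *
        expVal R' (φ V.1 * A * (φ V.1).conjTranspose) ∂ν := by
  rw [hν.integral_expVal_mul_eq_haar φ, ← integral_mul_left_eq_self (μ := haar d) _ w]
  exact hν.integral_expVal_mul_eq_haar (φ.comp (LinearMap.mulLeft ℂ w.1)) A R R'

/-! ### Resampling one coordinate of a product measure -/

lemma measurePreserving_update {ι : Type*} [Fintype ι] [DecidableEq ι] {X : ι → Type*}
    [∀ i, MeasurableSpace (X i)] (μ : ∀ i, Measure (X i)) [∀ i, IsProbabilityMeasure (μ i)]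
    (i : ι) :
    MeasurePreserving (fun p : (∀ j, X j) × X i => Function.update p.1 i p.2)
      ((Measure.pi μ).prod (μ i)) (Measure.pi μ) := by
  have hm : Measurable (fun p : (∀ j, X j) × X i => Function.update p.1 i p.2) := by
    refine measurable_pi_lambda _ fun j => ?_
    by_cases h : j = i
    · subst h
      simpa using measurable_snd
    · simpa [h, Function.comp_def] using (measurable_pi_apply j).comp measurable_fst
  refine ⟨hm, (Measure.pi_eq fun s hs => ?_).symm⟩
  rw [Measure.map_apply hm (MeasurableSet.univ_pi hs)]
  have : (fun p : (∀ j, X j) × X i => Function.update p.1 i p.2) ⁻¹' Set.univ.pi s =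
      (Set.univ.pi (Function.update s i Set.univ)) ×ˢ s i := by
    ext p
    simp only [Set.mem_preimage, Set.mem_pi, Set.mem_univ, true_implies, Set.mem_prod]
    constructor
    · intro h
      refine ⟨fun j => ?_, by simpa using h i⟩
      by_cases hj : j = i
      · subst hj; simp
      · simpa [hj] using h j
    · rintro ⟨h1, h2⟩ j
      by_cases hj : j = i
      · subst hj; simpa using h2
      · simpa [hj] using h1 j
  rw [this, Measure.prod_prod, Measure.pi_pi, ← Finset.mul_prod_erase _ _ (Finset.mem_univ i),
    ← Finset.mul_prod_erase (s := Finset.univ) (a := i) _ (Finset.mem_univ i)]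
  simp only [Function.update_self, measure_univ, one_mul]
  rw [mul_comm]
  congr 1
  exact Finset.prod_congr rfl fun j hj => by
    rw [Function.update_of_ne (Finset.ne_of_mem_erase hj)]

lemma integral_pi_update {ι : Type*} [Fintype ι] [DecidableEq ι] {X : ι → Type*}
    [∀ i, MeasurableSpace (X i)] (μ : ∀ i, Measure (X i)) [∀ i, IsProbabilityMeasure (μ i)]
    (i : ι) {F : (∀ j, X j) → ℝ} (hF : Integrable F (Measure.pi μ)) :
    ∫ ω, F ω ∂Measure.pi μ = ∫ ω, ∫ v, F (Function.update ω i v) ∂μ i ∂Measure.pi μ := by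
  have hp := measurePreserving_update μ i
  rw [← integral_prod (fun p : (∀ j, X j) × X i => F (Function.update p.1 i p.2))
    (hp.integrable_comp_of_integrable hF),
    ← integral_map hp.aemeasurable (by rw [hp.map_eq]; exact hF.aestronglyMeasurable), hp.map_eq]

/-- A transformation of one coordinate that preserves all partial integrals preserves the
integral. -/
lemma integral_pi_transform {ι : Type*} [Fintype ι] [DecidableEq ι] {X : ι → Type*}
    [∀ i, MeasurableSpace (X i)] (μ : ∀ i, Measure (X i)) [∀ i, IsProbabilityMeasure (μ i)]
    (i : ι) (T : X i → X i) {F : (∀ j, X j) → ℝ} (hF : Integrable F (Measure.pi μ))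
    (hFT : Integrable (fun ω => F (Function.update ω i (T (ω i)))) (Measure.pi μ))
    (h : ∀ ω, ∫ v, F (Function.update ω i (T v)) ∂μ i = ∫ v, F (Function.update ω i v) ∂μ i) :
    ∫ ω, F (Function.update ω i (T (ω i))) ∂Measure.pi μ = ∫ ω, F ω ∂Measure.pi μ := by
  rw [integral_pi_update μ i hF, integral_pi_update μ i hFT]
  simp [h]

/-! ### Two-qubit gates inside a register -/

lemma site_apply {n : ℕ} (i : Fin n) (w : Matrix (Fin 2) (Fin 2) ℂ) (x y : Bits n) :
    site i w x y = if ∀ k, k ≠ i → x k = y k then w (x i) (y i) else 0 := by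
  rw [site, tensor_update]
  simp only [Matrix.one_apply, Finset.prod_ite_zero, Finset.mem_erase, Finset.mem_univ, and_true,
    Finset.prod_const_one, mul_ite, mul_one, mul_zero]

/-- Row `x` of an embedded gate is supported on the four bit strings that agree with `x` away from
`i` and `j`. -/
lemma applyPair_mul_apply {n : ℕ} {i j : Fin n} (hij : i ≠ j)
    (g : Matrix (Fin 2 × Fin 2) (Fin 2 × Fin 2) ℂ) (B : Op n) (x y : Bits n) :
    (applyPair i j g * B) x y = ∑ p : Fin 2 × Fin 2, g (x i, x j) p *
      B (Function.update (Function.update x i p.1) j p.2) y := by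
  rw [Matrix.mul_apply]
  symm
  have hval : ∀ p : Fin 2 × Fin 2,
      Function.update (Function.update x i p.1) j p.2 i = p.1 ∧
      Function.update (Function.update x i p.1) j p.2 j = p.2 := by
    intro p; simp [hij]
  refine Fintype.sum_of_injective
    (fun p : Fin 2 × Fin 2 => Function.update (Function.update x i p.1) j p.2) ?_ _ _ ?_ ?_
  · intro p q h
    have h1 := congrFun h i
    have h2 := congrFun h j
    simp only [hval] at h1 h2
    exact Prod.ext h1 h2
  · intro z hz
    rw [applyPair, Matrix.of_apply, if_neg, zero_mul]
    intro h
    refine hz ⟨(z i, z j), ?_⟩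
    ext1 k
    by_cases hkj : k = j
    · subst hkj; simp
    · by_cases hki : k = i
      · subst hki; simp [hkj]
      · simp [hkj, hki, h k hki hkj]
  · intro p
    rw [applyPair, Matrix.of_apply, if_pos, (hval p).1, (hval p).2]
    intro k hki hkj
    simp [hki, hkj]

lemma applyPair_mul {n : ℕ} {i j : Fin n} (hij : i ≠ j)
    (g h : Matrix (Fin 2 × Fin 2) (Fin 2 × Fin 2) ℂ) :
    applyPair i j g * applyPair i j h = applyPair i j (g * h) := by
  ext x y
  rw [applyPair_mul_apply hij]
  have hc : ∀ p : Fin 2 × Fin 2,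
      (∀ k, k ≠ i → k ≠ j → Function.update (Function.update x i p.1) j p.2 k = y k) ↔
      ∀ k, k ≠ i → k ≠ j → x k = y k := by
    intro p
    refine forall_congr' fun k => ?_
    by_cases hki : k = i <;> by_cases hkj : k = j <;> simp [hki, hkj]
  simp only [applyPair, Matrix.of_apply, hc]
  split_ifs
  · rw [Matrix.mul_apply]
    simp [hij]
  · simp

lemma applyPair_one {n : ℕ} (i j : Fin n) : applyPair i j 1 = 1 := by
  ext x y
  simp only [applyPair, Matrix.of_apply, Matrix.one_apply, Prod.mk.injEq]
  by_cases h : x = y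
  · simp [h]
  · rw [if_neg h]
    by_cases hk : ∀ k, k ≠ i → k ≠ j → x k = y k
    · rw [if_pos hk, if_neg]
      rintro ⟨h1, h2⟩
      refine h (funext fun k => ?_)
      by_cases hki : k = i
      · rw [hki, h1]
      · by_cases hkj : k = j
        · rw [hkj, h2]
        · exact hk k hki hkj
    · rw [if_neg hk]

lemma applyPair_conjTranspose {n : ℕ} (i j : Fin n)
    (g : Matrix (Fin 2 × Fin 2) (Fin 2 × Fin 2) ℂ) :
    (applyPair i j g).conjTranspose = applyPair i j g.conjTranspose := by
  ext x y
  simp only [applyPair, Matrix.conjTranspose_apply, Matrix.of_apply, @eq_comm _ (y _)]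
  split_ifs <;> simp

lemma applyPair_conjTranspose_mul {n : ℕ} {i j : Fin n} (hij : i ≠ j) (u : U (Fin 2 × Fin 2)) :
    (applyPair i j u.1).conjTranspose * applyPair i j u.1 = 1 := by
  rw [applyPair_conjTranspose, applyPair_mul hij, unitary_conjTranspose_mul, applyPair_one]

/-- `applyPair` as a linear map. -/
def applyPairLinear {n : ℕ} (i j : Fin n) :
    Matrix (Fin 2 × Fin 2) (Fin 2 × Fin 2) ℂ →ₗ[ℂ] Op n where
  toFun := applyPair i j
  map_add' g h := by
    ext x y
    simp only [applyPair, Matrix.of_apply, Matrix.add_apply]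
    split_ifs <;> simp
  map_smul' c g := by
    ext x y
    simp [applyPair]

lemma site_fst_eq_applyPair {n : ℕ} {i j : Fin n} (hij : i ≠ j)
    (w : Matrix (Fin 2) (Fin 2) ℂ) : site i w = applyPair i j (w ⊗ₖ 1) := by
  ext x y
  rw [site_apply, applyPair, Matrix.of_apply, Matrix.kronecker_apply, Matrix.one_apply]
  by_cases h : x j = y j
  · rw [if_pos h, mul_one]
    refine if_congr (forall_congr' fun k => ?_) rfl rfl
    by_cases hk : k = j
    · subst hk; simp [h]
    · simp [hk]
  · rw [if_neg h, mul_zero, ite_self, if_neg]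
    exact fun h' => h (h' j hij.symm)

lemma site_snd_eq_applyPair {n : ℕ} {i j : Fin n} (hij : i ≠ j)
    (w : Matrix (Fin 2) (Fin 2) ℂ) : site j w = applyPair i j (1 ⊗ₖ w) := by
  ext x y
  rw [site_apply, applyPair, Matrix.of_apply, Matrix.kronecker_apply, Matrix.one_apply]
  by_cases h : x i = y i
  · rw [if_pos h, one_mul]
    refine if_congr (forall_congr' fun k => ?_) rfl rfl
    by_cases hk : k = i
    · subst hk; simp [h]
    · simp [hk]
  · rw [if_neg h, zero_mul, ite_self, if_neg]
    exact fun h' => h (h' i hij)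

lemma site_mul_apply {n : ℕ} (k : Fin n) (w : Matrix (Fin 2) (Fin 2) ℂ) (B : Op n) (x y : Bits n) :
    (site k w * B) x y = ∑ c, w (x k) c * B (Function.update x k c) y := by
  rw [Matrix.mul_apply]
  symm
  refine Fintype.sum_of_injective (fun c => Function.update x k c)
    (Function.update_injective x k) _ _ ?_ ?_
  · intro z hz
    rw [site_apply, if_neg, zero_mul]
    intro h
    refine hz ⟨z k, ?_⟩
    ext1 l
    by_cases hl : l = k
    · subst hl; simp
    · simp [hl, h l hl]
  · intro c
    rw [site_apply, if_pos]
    · simp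
    · intro l hl; simp [hl]

lemma mul_site_apply {n : ℕ} (k : Fin n) (w : Matrix (Fin 2) (Fin 2) ℂ) (B : Op n) (x y : Bits n) :
    (B * site k w) x y = ∑ c, B x (Function.update y k c) * w c (y k) := by
  have h := congrArg star (site_mul_apply k w.conjTranspose B.conjTranspose y x)
  rw [← Matrix.conjTranspose_apply, Matrix.conjTranspose_mul, site_conjTranspose] at h
  simpa [mul_comm] using h

lemma site_mul_applyPair_comm {n : ℕ} {i j k : Fin n} (hki : k ≠ i) (hkj : k ≠ j)
    (w : Matrix (Fin 2) (Fin 2) ℂ) (g : Matrix (Fin 2 × Fin 2) (Fin 2 × Fin 2) ℂ) :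
    site k w * applyPair i j g = applyPair i j g * site k w := by
  ext x y
  rw [site_mul_apply, mul_site_apply, Finset.sum_eq_single (y k), Finset.sum_eq_single (x k)]
  · simp only [applyPair, Matrix.of_apply, Function.update_of_ne hki.symm,
      Function.update_of_ne hkj.symm]
    rw [mul_comm]
    congr 1
    refine if_congr (forall_congr' fun l => ?_) rfl rfl
    by_cases hl : l = k
    · subst hl; simp
    · simp [hl]
  · intro c _ hc
    rw [applyPair, Matrix.of_apply, if_neg, zero_mul]
    intro h
    have := h k hki hkj
    simp only [Function.update_self] at this
    exact hc this.symm
  · simp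
  · intro c _ hc
    rw [applyPair, Matrix.of_apply, if_neg, mul_zero]
    intro h
    have := h k hki hkj
    simp only [Function.update_self] at this
    exact hc this
  · simp

/-! ### Products of gates -/

/-- The product of the gates `g k` on the pairs `(a k, b k)`, the gate `0` being applied first. -/
def gateProduct {n : ℕ} (m : ℕ) (a b : Fin m → Fin n)
    (g : Fin m → Matrix (Fin 2 × Fin 2) (Fin 2 × Fin 2) ℂ) : Op n :=
  Fin.foldl m (fun W k => applyPair (a k) (b k) (g k) * W) 1

lemma gateProduct_succ {n : ℕ} (m : ℕ) (a b : Fin (m + 1) → Fin n)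
    (g : Fin (m + 1) → Matrix (Fin 2 × Fin 2) (Fin 2 × Fin 2) ℂ) :
    gateProduct (m + 1) a b g = applyPair (a (Fin.last m)) (b (Fin.last m)) (g (Fin.last m)) *
      gateProduct m (fun k => a k.castSucc) (fun k => b k.castSucc) (fun k => g k.castSucc) := by
  rw [gateProduct, Fin.foldl_succ_last]
  rfl

lemma update_last_castSucc {m : ℕ} {X : Type*} (g : Fin (m + 1) → X) (v : X) :
    (fun k : Fin m => Function.update g (Fin.last m) v k.castSucc) = fun k => g k.castSucc := by
  ext1 k
  rw [Function.update_of_ne (Fin.castSucc_lt_last k).ne]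

lemma update_castSucc_castSucc {m : ℕ} {X : Type*} (g : Fin (m + 1) → X) (l : Fin m) (v : X) :
    (fun k : Fin m => Function.update g l.castSucc v k.castSucc) =
      Function.update (fun k => g k.castSucc) l v := by
  ext1 k
  by_cases h : k = l
  · subst h; simp
  · simp [h]

lemma update_castSucc_last {m : ℕ} {X : Type*} (g : Fin (m + 1) → X) (l : Fin m) (v : X) :
    Function.update g l.castSucc v (Fin.last m) = g (Fin.last m) := by
  rw [Function.update_of_ne (Fin.castSucc_lt_last l).ne']

/-- A product of gates is linear in each gate. -/
lemma exists_linear_gateProduct {n : ℕ} : ∀ (m : ℕ) (a b : Fin m → Fin n)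
    (g : Fin m → Matrix (Fin 2 × Fin 2) (Fin 2 × Fin 2) ℂ) (l : Fin m),
    ∃ φ : Matrix (Fin 2 × Fin 2) (Fin 2 × Fin 2) ℂ →ₗ[ℂ] Op n,
      ∀ v, gateProduct m a b (Function.update g l v) = φ v := by
  intro m
  induction m with
  | zero => exact fun _ _ _ l => l.elim0
  | succ m ih =>
    intro a b g l
    induction l using Fin.lastCases with
    | last =>
      refine ⟨(LinearMap.mulRight ℂ (gateProduct m (fun k => a k.castSucc)
        (fun k => b k.castSucc) (fun k => g k.castSucc))).comp
          (applyPairLinear (a (Fin.last m)) (b (Fin.last m))), fun v => ?_⟩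
      rw [gateProduct_succ, update_last_castSucc, Function.update_self]
      rfl
    | cast l =>
      obtain ⟨φ, hφ⟩ := ih (fun k => a k.castSucc) (fun k => b k.castSucc)
        (fun k => g k.castSucc) l
      refine ⟨(LinearMap.mulLeft ℂ
        (applyPair (a (Fin.last m)) (b (Fin.last m)) (g (Fin.last m)))).comp φ, fun v => ?_⟩
      rw [gateProduct_succ, update_castSucc_castSucc, update_castSucc_last, hφ]
      rfl

/-- The unitary `w ⊗ 1`. -/
def kroneckerOne (w : U (Fin 2)) : U (Fin 2 × Fin 2) :=
  ⟨w.1 ⊗ₖ 1, Matrix.kronecker_mem_unitary w.2 (one_mem _)⟩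

/-- The unitary `1 ⊗ w`. -/
def oneKronecker (w : U (Fin 2)) : U (Fin 2 × Fin 2) :=
  ⟨1 ⊗ₖ w.1, Matrix.kronecker_mem_unitary (one_mem _) w.2⟩

/-- A single-qubit unitary after a product of gates is absorbed by the last gate on its qubit. -/
lemma exists_absorbing_gate {n : ℕ} (i : Fin n) (w : U (Fin 2)) : ∀ (m : ℕ) (a b : Fin m → Fin n),
    (∀ k, a k ≠ b k) → (∃ k, a k = i ∨ b k = i) →
    ∃ (l : Fin m) (w' : U (Fin 2 × Fin 2)), ∀ g,
      site i w.1 * gateProduct m a b g = gateProduct m a b (Function.update g l (w'.1 * g l)) := by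
  intro m
  induction m with
  | zero => exact fun _ _ _ h => h.choose.elim0
  | succ m ih =>
    intro a b hab hcov
    by_cases ha : a (Fin.last m) = i
    · refine ⟨Fin.last m, kroneckerOne w, fun g => ?_⟩
      rw [gateProduct_succ, gateProduct_succ, update_last_castSucc, Function.update_self, ← mul_assoc,
        ← ha, site_fst_eq_applyPair (hab _), applyPair_mul (hab _)]
      rfl
    · by_cases hb : b (Fin.last m) = i
      · refine ⟨Fin.last m, oneKronecker w, fun g => ?_⟩
        rw [gateProduct_succ, gateProduct_succ, update_last_castSucc, Function.update_self,
          ← mul_assoc, ← hb, site_snd_eq_applyPair (hab _), applyPair_mul (hab _)]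
        rfl
      · obtain ⟨k, hk⟩ := hcov
        have hex : ∃ k : Fin m, a k.castSucc = i ∨ b k.castSucc = i := by
          induction k using Fin.lastCases with
          | last => exact absurd hk (by simp [ha, hb])
          | cast k => exact ⟨k, hk⟩
        obtain ⟨l, w', h⟩ := ih (fun k => a k.castSucc) (fun k => b k.castSucc)
          (fun k => hab _) hex
        refine ⟨l.castSucc, w', fun g => ?_⟩
        rw [gateProduct_succ, gateProduct_succ, update_castSucc_castSucc, update_castSucc_last,
          ← mul_assoc, site_mul_applyPair_comm (Ne.symm ha) (Ne.symm hb), mul_assoc, h]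

lemma gateProduct_conjTranspose_mul {n : ℕ} : ∀ (m : ℕ) (a b : Fin m → Fin n),
    (∀ k, a k ≠ b k) → ∀ u : Fin m → U (Fin 2 × Fin 2),
    (gateProduct m a b fun k => (u k).1).conjTranspose * (gateProduct m a b fun k => (u k).1) = 1 := by
  intro m
  induction m with
  | zero => intro a b _ u; simp [gateProduct]
  | succ m ih =>
    intro a b hab u
    rw [gateProduct_succ, Matrix.conjTranspose_mul, mul_assoc, ← mul_assoc (applyPair _ _ _).conjTranspose,
      applyPair_conjTranspose_mul (hab _), one_mul]
    exact ih _ _ (fun k => hab _) fun k => u k.castSucc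

lemma continuous_gateProduct {n : ℕ} : ∀ (m : ℕ) (a b : Fin m → Fin n),
    Continuous fun u : Fin m → U (Fin 2 × Fin 2) => gateProduct m a b fun k => (u k).1 := by
  intro m
  induction m with
  | zero => intro a b; exact continuous_const
  | succ m ih =>
    intro a b
    simp only [gateProduct_succ]
    refine Continuous.mul ?_ ((ih _ _).comp (f := fun u : Fin (m + 1) → U (Fin 2 × Fin 2) =>
      fun k : Fin m => u k.castSucc) (by fun_prop))
    exact (LinearMap.continuous_of_finiteDimensional (applyPairLinear _ _)).comp
      (continuous_subtype_val.comp (continuous_apply _))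

/-! ### Random operators with locally invariant second moments -/

/-- The second moments of the random operator `M` do not change under conjugation by single-qubit
unitaries. -/
def LocallyInvariant {Ω : Type*} [MeasurableSpace Ω] {n : ℕ} (μ : Measure Ω) (M : Ω → Op n) : Prop :=
  ∀ (i : Fin n) (w : U (Fin 2)) (R R' : Op n),
    ∫ ω, expVal R (site i w.1 * M ω * (site i w.1).conjTranspose) *
        expVal R' (site i w.1 * M ω * (site i w.1).conjTranspose) ∂μ =
      ∫ ω, expVal R (M ω) * expVal R' (M ω) ∂μ

/-- At a site where `P` and `Q` differ, some Pauli commutes with one and anticommutes with the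
other. Invariance under it makes the integral equal to its own negative. The rotation by `v` is
carried along because the noise has an input rotation. -/
lemma LocallyInvariant.integral_pauli_mul_pauli {Ω : Type*} [MeasurableSpace Ω] {n : ℕ}
    {μ : Measure Ω} {M : Ω → Op n} (h : LocallyInvariant μ M) (v : U (Fin 2))
    {P Q : PauliString n} (hPQ : P ≠ Q) :
    ∫ ω, expVal (pauliOp P) ((tensor fun _ => v.1.conjTranspose) * M ω *
        (tensor fun _ => v.1.conjTranspose).conjTranspose) *
      expVal (pauliOp Q) ((tensor fun _ => v.1.conjTranspose) * M ω *
        (tensor fun _ => v.1.conjTranspose).conjTranspose) ∂μ = 0 := by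
  obtain ⟨i, hi⟩ := Function.ne_iff.mp hPQ
  obtain ⟨s, e, f, hef, he, hf⟩ := exists_pauli_separating _ _ hi
  have hs : pauli s ∈ Matrix.unitaryGroup (Fin 2) ℂ := by
    rw [Matrix.mem_unitaryGroup_iff, Matrix.star_eq_conjTranspose, pauli_conjTranspose,
      pauli_mul_self]
  -- The separating Pauli in the frame rotated by `v`: it acts by a sign on each rotated string.
  let w : U (Fin 2) := v * ⟨pauli s, hs⟩ * v⁻¹
  have hw : w.1 = v.1 * pauli s * v.1.conjTranspose := rfl
  have hwc : w.1.conjTranspose = v.1 * pauli s * v.1.conjTranspose := by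
    rw [hw]
    simp [Matrix.conjTranspose_mul, pauli_conjTranspose, mul_assoc]
  have hconj : ∀ (R : PauliString n) (x : ℝ),
      pauli s * pauli (R i) * pauli s = (x : ℂ) • pauli (R i) →
      (site i w.1).conjTranspose * (tensor (fun _ => v.1) * pauliOp R *
        tensor (fun _ => v.1.conjTranspose)) * site i w.1 =
      (x : ℂ) • (tensor (fun _ => v.1) * pauliOp R * tensor (fun _ => v.1.conjTranspose)) := by
    intro R x hx
    rw [site_conjTranspose, pauliOp, tensor_mul, tensor_mul, site_mul_tensor, tensor_mul_site,
      hwc, hw, Function.update_self, Function.update_idem]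
    have h1 : v.1 * pauli s * v.1.conjTranspose * (v.1 * pauli (R i) * v.1.conjTranspose) *
        (v.1 * pauli s * v.1.conjTranspose) =
        (x : ℂ) • (v.1 * pauli (R i) * v.1.conjTranspose) := by
      calc _ = v.1 * pauli s * (v.1.conjTranspose * v.1) * pauli (R i) *
            (v.1.conjTranspose * v.1) * pauli s * v.1.conjTranspose := by simp only [mul_assoc]
        _ = v.1 * (pauli s * pauli (R i) * pauli s) * v.1.conjTranspose := by
            rw [unitary_conjTranspose_mul]; simp only [mul_assoc, one_mul]
        _ = _ := by rw [hx, Matrix.mul_smul, Matrix.smul_mul]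
    rw [h1]
    change tensorAt _ i _ = _
    rw [map_smul]
    congr 1
    exact congrArg tensor (Function.update_eq_self i _)
  have := h i w (tensor (fun _ => v.1) * pauliOp P * tensor (fun _ => v.1.conjTranspose))
    (tensor (fun _ => v.1) * pauliOp Q * tensor (fun _ => v.1.conjTranspose))
  simp only [expVal_conj _ (site i w.1), hconj P e he, hconj Q f hf, expVal_smul_left] at this
  simp only [expVal_conj _ (tensor _)]
  simp only [tensor_conjTranspose, Matrix.conjTranspose_conjTranspose]
  have e2 : ∀ a b : ℝ, e * a * (f * b) = (-1) * (a * b) := fun a b => by rw [← hef]; ring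
  simp only [e2, integral_const_mul] at this
  linarith

lemma LocallyInvariant.integral_pauli_mul_pauli_one {Ω : Type*} [MeasurableSpace Ω] {n : ℕ}
    {μ : Measure Ω} {M : Ω → Op n} (h : LocallyInvariant μ M) {P Q : PauliString n} (hPQ : P ≠ Q) :
    ∫ ω, expVal (pauliOp P) (M ω) * expVal (pauliOp Q) (M ω) ∂μ = 0 := by
  simpa [tensor_one] using h.integral_pauli_mul_pauli 1 hPQ

lemma LocallyInvariant.integral_sq_update {Ω : Type*} [MeasurableSpace Ω] {n : ℕ}
    {μ : Measure Ω} {M : Ω → Op n} (h : LocallyInvariant μ M) (P : PauliString n) (i : Fin n)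
    (q : Fin 4) (hq : q = 0 ↔ P i = 0) :
    ∫ ω, expVal (pauliOp (Function.update P i q)) (M ω) ^ 2 ∂μ =
      ∫ ω, expVal (pauliOp P) (M ω) ^ 2 ∂μ := by
  have step : ∀ P : PauliString n, ∫ ω, expVal (pauliOp (Function.update P i
      (if P i = 0 then 0 else if P i = 1 then 2 else if P i = 2 then 3 else 1))) (M ω) ^ 2 ∂μ =
      ∫ ω, expVal (pauliOp P) (M ω) ^ 2 ∂μ := by
    intro P
    have := h i cyclicClifford (pauliOp P) (pauliOp P)
    simp only [expVal_conj, ← sq] at this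
    rw [← this]
    congr 2
    ext1 ω
    congr 2
    rw [pauliOp, pauliOp, site_conjTranspose, site_mul_tensor, tensor_mul_site,
      Function.update_self, Function.update_idem, cyclicClifford_conj]
    congr 1
    ext1 j
    by_cases hj : j = i
    · subst hj; simp
    · simp [hj]
  have step' : ∀ p q : Fin 4,
      (if p = 0 then 0 else if p = 1 then 2 else if p = 2 then 3 else 1) = q →
      ∫ ω, expVal (pauliOp (Function.update P i q)) (M ω) ^ 2 ∂μ =
      ∫ ω, expVal (pauliOp (Function.update P i p)) (M ω) ^ 2 ∂μ := by
    rintro p q rfl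
    simpa using step (Function.update P i p)
  -- Two links of the cycle already connect all three nontrivial labels.
  have h12 := step' 1 2 (by decide)
  have h23 := step' 2 3 (by decide)
  have all : ∀ p q : Fin 4, (q = 0 ↔ p = 0) →
      ∫ ω, expVal (pauliOp (Function.update P i q)) (M ω) ^ 2 ∂μ =
      ∫ ω, expVal (pauliOp (Function.update P i p)) (M ω) ^ 2 ∂μ := by
    intro p q hpq
    fin_cases p <;> fin_cases q <;> simp at hpq ⊢ <;> simp only [h12, h23]
  simpa using all (P i) q hq

lemma LocallyInvariant.integral_sq_eq_of_mem_supportClass {Ω : Type*} [MeasurableSpace Ω] {n : ℕ}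
    {μ : Measure Ω} {M : Ω → Op n} (h : LocallyInvariant μ M) {P Q : PauliString n}
    (hQ : Q ∈ supportClass P) :
    ∫ ω, expVal (pauliOp Q) (M ω) ^ 2 ∂μ = ∫ ω, expVal (pauliOp P) (M ω) ^ 2 ∂μ := by
  rw [mem_supportClass] at hQ
  -- `P` is changed into `Q` one qubit at a time.
  have key : ∀ s : Finset (Fin n), ∫ ω, expVal (pauliOp (s.piecewise Q P)) (M ω) ^ 2 ∂μ =
      ∫ ω, expVal (pauliOp P) (M ω) ^ 2 ∂μ := by
    intro s
    induction s using Finset.induction_on with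
    | empty => simp
    | insert i s his ih =>
      rw [Finset.piecewise_insert, h.integral_sq_update, ih]
      simp [his, hQ]
  simpa using key Finset.univ

/-! ### Layers of 2-designs are locally invariant -/

lemma coe_update {ι : Type*} [DecidableEq ι] {d : Type} [Fintype d] [DecidableEq d]
    (ω : ι → U d) (i : ι) (V : U d) :
    (fun j => (Function.update ω i V j).1) = Function.update (fun j => (ω j).1) i V.1 := by
  ext1 j
  by_cases hj : j = i
  · subst hj; simp
  · simp [hj]

lemma continuous_tensor {n : ℕ} :
    Continuous fun ω : Fin n → U (Fin 2) => tensor fun i => (ω i).1 := by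
  refine continuous_matrix fun x y => ?_
  simp only [tensor, Matrix.of_apply]
  exact continuous_finsetProd _ fun i _ =>
    (continuous_entry (x i) (y i)).comp (continuous_apply i)

lemma continuous_expVal_conj {X : Type*} [TopologicalSpace X] {n : ℕ} {W : X → Op n}
    (hW : Continuous W) (R A : Op n) :
    Continuous fun x => expVal R (W x * A * (W x).conjTranspose) :=
  (continuous_expVal R).comp ((hW.mul continuous_const).mul hW.matrix_conjTranspose)

lemma locallyInvariant_tensor {n : ℕ} {ν : Fin n → Measure (U (Fin 2))}
    (hν : ∀ i, IsTwoDesign (ν i)) (A : Op n) :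
    LocallyInvariant (Measure.pi ν) fun ω =>
      (tensor fun i => (ω i).1) * A * (tensor fun i => (ω i).1).conjTranspose := by
  have := fun i => (hν i).isProbabilityMeasure
  intro i w R R'
  let F : (Fin n → U (Fin 2)) → ℝ := fun ω =>
      expVal R ((tensor fun i => (ω i).1) * A * (tensor fun i => (ω i).1).conjTranspose) *
      expVal R' ((tensor fun i => (ω i).1) * A * (tensor fun i => (ω i).1).conjTranspose)
  have hc : Continuous F :=
    (continuous_expVal_conj continuous_tensor R A).mul
      (continuous_expVal_conj continuous_tensor R' A)
  have hT : Continuous fun ω : Fin n → U (Fin 2) => Function.update ω i (w * ω i) :=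
    continuous_id.update i (continuous_const.mul (continuous_apply i))
  have h1 : Integrable F (Measure.pi ν) := integrable_of_continuous hc
  have h2 : Integrable (fun ω => F (Function.update ω i (w * ω i))) (Measure.pi ν) :=
    integrable_of_continuous (hc.comp hT)
  refine Eq.trans ?_ (integral_pi_transform ν i (fun V => w * V) h1 h2 ?_)
  · refine integral_congr_ae (.of_forall fun ω => ?_)
    have e : site i w.1 * (tensor fun i => (ω i).1) =
        tensor fun j => (Function.update ω i (w * ω i) j).1 := by
      rw [site_mul_tensor, coe_update]
      rfl
    simp only [← e, Matrix.conjTranspose_mul, mul_assoc]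
  · intro ω
    simp only [coe_update]
    exact (hν i).integral_expVal_mul_left (tensorAt (fun j => (ω j).1) i) A R R' w

lemma Layer.continuous_unitary {n : ℕ} (ℓ : Layer n) : Continuous ℓ.unitary :=
  continuous_gateProduct _ _ _

lemma Layer.unitary_conjTranspose_mul {n : ℕ} (ℓ : Layer n)
    (u : Fin ℓ.numGates → U (Fin 2 × Fin 2)) :
    (ℓ.unitary u).conjTranspose * ℓ.unitary u = 1 :=
  gateProduct_conjTranspose_mul _ _ _ ℓ.fst_ne_snd u

/-- Every qubit is covered, so the extra unitary becomes a left translation of one gate. With the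
other gates fixed, the layer is linear in that gate and the 2-design property applies. -/
lemma Layer.locallyInvariant {n : ℕ} (ℓ : Layer n) (A : Op n) :
    LocallyInvariant (Measure.pi ℓ.gateLaw) fun u =>
      ℓ.unitary u * A * (ℓ.unitary u).conjTranspose := by
  have := fun g => (ℓ.gateLaw_isTwoDesign g).isProbabilityMeasure
  intro i w R R'
  obtain ⟨l, w', h⟩ := exists_absorbing_gate i w ℓ.numGates ℓ.fst ℓ.snd ℓ.fst_ne_snd (ℓ.covers i)
  let F : (Fin ℓ.numGates → U (Fin 2 × Fin 2)) → ℝ := fun u =>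
      expVal R (ℓ.unitary u * A * (ℓ.unitary u).conjTranspose) *
      expVal R' (ℓ.unitary u * A * (ℓ.unitary u).conjTranspose)
  have hc : Continuous F :=
    (continuous_expVal_conj ℓ.continuous_unitary R A).mul
      (continuous_expVal_conj ℓ.continuous_unitary R' A)
  have hT : Continuous fun u : Fin ℓ.numGates → U (Fin 2 × Fin 2) =>
      Function.update u l (w' * u l) :=
    continuous_id.update l (continuous_const.mul (continuous_apply l))
  have h1 : Integrable F (Measure.pi ℓ.gateLaw) := integrable_of_continuous hc
  have h2 : Integrable (fun u => F (Function.update u l (w' * u l))) (Measure.pi ℓ.gateLaw) :=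
    integrable_of_continuous (hc.comp hT)
  refine Eq.trans ?_ (integral_pi_transform ℓ.gateLaw l (fun V => w' * V) h1 h2 ?_)
  · refine integral_congr_ae (.of_forall fun u => ?_)
    have e : site i w.1 * ℓ.unitary u = ℓ.unitary (Function.update u l (w' * u l)) := by
      change site i w.1 * gateProduct _ _ _ (fun k => (u k).1) =
        gateProduct _ _ _ (fun k => (Function.update u l (w' * u l) k).1)
      rw [h, coe_update]
      rfl
    simp only [← e, Matrix.conjTranspose_mul, mul_assoc]
  · intro u
    obtain ⟨φ, hφ⟩ := exists_linear_gateProduct ℓ.numGates ℓ.fst ℓ.snd (fun k => (u k).1) l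
    have e : ∀ V, ℓ.unitary (Function.update u l V) = φ V.1 := by
      intro V
      rw [← hφ, ← coe_update]
      rfl
    simp only [e]
    exact (ℓ.gateLaw_isTwoDesign l).integral_expVal_mul_left φ A R R' w'

/-! ### Tensor powers of a map in normal form -/

lemma tensorMap_tensor {n : ℕ} (M : Fin n → QubitMap) (A : Fin n → Matrix (Fin 2) (Fin 2) ℂ) :
    tensorMap M (tensor A) = tensor fun i => M i (A i) := by
  have h : ∀ i, M i (A i) = ∑ a, ∑ b, A i a b • M i (Matrix.single a b 1) := by
    intro i
    conv_lhs => rw [Matrix.matrix_eq_sum_single (A i)]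
    simp only [map_sum, ← map_smul, Matrix.smul_single, smul_eq_mul, mul_one]
  ext p q
  simp only [tensorMap, Matrix.sum_apply, Matrix.smul_apply, tensor, Matrix.of_apply, smul_eq_mul,
    ← Finset.prod_mul_distrib]
  simp only [h, Matrix.sum_apply, Matrix.smul_apply, smul_eq_mul]
  rw [Fintype.prod_sum]
  exact Finset.sum_congr rfl fun x _ => by rw [Fintype.prod_sum]

lemma tensorMap_sum {n : ℕ} {ι : Type*} (M : Fin n → QubitMap) (s : Finset ι) (A : ι → Op n) :
    tensorMap M (∑ k ∈ s, A k) = ∑ k ∈ s, tensorMap M (A k) := by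
  simp only [tensorMap, Matrix.sum_apply, Finset.sum_smul]
  conv_rhs => rw [Finset.sum_comm]
  refine Finset.sum_congr rfl fun x _ => ?_
  rw [Finset.sum_comm]

lemma tensorMap_smul {n : ℕ} (M : Fin n → QubitMap) (c : ℂ) (A : Op n) :
    tensorMap M (c • A) = c • tensorMap M A := by
  simp only [tensorMap, Matrix.smul_apply, Finset.smul_sum, smul_smul, smul_eq_mul]

lemma tensorMap_comp {n : ℕ} (M M' : Fin n → QubitMap) (A : Op n) :
    tensorMap (fun i => (M i).comp (M' i)) A = tensorMap M (tensorMap M' A) := by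
  conv_rhs => rw [tensorMap.eq_def M' A]
  simp only [tensorMap_sum, tensorMap_smul, tensorMap_tensor]
  rfl

lemma continuous_tensorChannel (N : QubitMap) {n : ℕ} :
    Continuous fun A : Op n => tensorChannel N A := by
  unfold tensorChannel
  exact continuous_finsetSum _ fun x _ => continuous_finsetSum _ fun y _ =>
    (continuous_apply_apply x y).smul continuous_const

/-- The second moments over a support class after the noise, in terms of those before it. -/
lemma HasNormalForm.exists_expansion {N : QubitMap} {t D : EuclideanSpace ℝ (Fin 3)}
    (h : HasNormalForm N t D) : ∃ v : U (Fin 2), ∀ (n : ℕ) (P : PauliString n) (B : Op n),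
      ∑ Q ∈ supportClass P, expVal (pauliOp Q) (tensorChannel N B) ^ 2 =
      ∑ Q ∈ supportClass P, (∑ Q' : PauliString n,
        (∏ i, normalTransfer t D (Q i) (Q' i)) *
          expVal (pauliOp Q') ((tensor fun _ => v.1.conjTranspose) * B *
            (tensor fun _ => v.1.conjTranspose).conjTranspose)) ^ 2 := by
  obtain ⟨u, v, N', h0, hk, hconj⟩ := h
  refine ⟨v, fun n P B => ?_⟩
  have hN : N = (conjMap u.1).comp (N'.comp (conjMap v.1.conjTranspose)) := by
    ext1 A
    simp [hconj, conjMap_apply]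
  have e : tensorChannel N B = (tensor fun _ => u.1) *
      tensorMap (fun _ => N') ((tensor fun _ => v.1.conjTranspose) * B *
        (tensor fun _ => v.1.conjTranspose).conjTranspose) *
      (tensor fun _ => u.1).conjTranspose := by
    rw [tensor_conj_eq_tensorMap, tensor_conj_eq_tensorMap, ← tensorMap_comp, ← tensorMap_comp,
      tensorChannel_eq_tensorMap, hN]
    rfl
  -- The output rotation `u` disappears in the sum over the support class; only the input rotation
  -- `v` survives.
  rw [e, sum_supportClass_tensor_conj (fun _ => u)]
  simp only [expVal_tensorMap fun _ => isTransfer_normalTransfer h0 hk]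

lemma sum_supportClass_normalTransfer_zero {n : ℕ} (t D : EuclideanSpace ℝ (Fin 3))
    (P : PauliString n) :
    ∑ Q ∈ supportClass P, (∏ i, normalTransfer t D (Q i) 0) ^ 2 = (‖t‖ ^ 2) ^ weight P := by
  simp only [← Finset.prod_pow]
  rw [supportClass, ← Finset.prod_univ_sum (fun i => labelClass (P i))
    (fun _ q => normalTransfer t D q 0 ^ 2)]
  simp only [sum_labelClass_normalTransfer_zero, prod_ite_support]

lemma sum_supportClass_normalTransfer {n : ℕ} (t D : EuclideanSpace ℝ (Fin 3))
    (P : PauliString n) :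
    ∑ Q ∈ supportClass P, ∑ Q' : PauliString n, (∏ i, normalTransfer t D (Q i) (Q' i)) ^ 2 =
      (‖t‖ ^ 2 + ‖D‖ ^ 2) ^ weight P := by
  simp only [← Finset.prod_pow]
  have h : ∀ Q : PauliString n, ∑ Q' : PauliString n, ∏ i, normalTransfer t D (Q i) (Q' i) ^ 2 =
      ∏ i, ∑ q, normalTransfer t D (Q i) q ^ 2 := fun Q => by rw [Fintype.prod_sum]
  simp only [h]
  rw [supportClass, ← Finset.prod_univ_sum (fun i => labelClass (P i))
    (fun _ q => ∑ q', normalTransfer t D q q' ^ 2)]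
  simp only [sum_labelClass_normalTransfer, prod_ite_support]

/-! ### Orthogonal sums -/

lemma integral_sq_sum_of_orthogonal {Ω ι : Type*} [MeasurableSpace Ω] [DecidableEq ι]
    {μ : Measure Ω} (s : Finset ι) (c : ι → ℝ) (y : ι → Ω → ℝ)
    (hint : ∀ i j, Integrable (fun ω => y i ω * y j ω) μ)
    (horth : ∀ i j, i ≠ j → ∫ ω, y i ω * y j ω ∂μ = 0) :
    ∫ ω, (∑ i ∈ s, c i * y i ω) ^ 2 ∂μ = ∑ i ∈ s, c i ^ 2 * ∫ ω, y i ω ^ 2 ∂μ := by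
  have h : ∀ ω, (∑ i ∈ s, c i * y i ω) ^ 2 =
      ∑ i ∈ s, ∑ j ∈ s, c i * c j * (y i ω * y j ω) := by
    intro ω
    rw [sq, Finset.sum_mul_sum]
    exact Finset.sum_congr rfl fun i _ => Finset.sum_congr rfl fun j _ => by ring
  simp only [h]
  rw [integral_finsetSum _ fun i _ => integrable_finsetSum _ fun j _ => (hint i j).const_mul _]
  refine Finset.sum_congr rfl fun i hi => ?_
  rw [integral_finsetSum _ fun j _ => (hint i j).const_mul _, Finset.sum_eq_single i]
  · rw [integral_const_mul]
    simp only [sq]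
  · intro j _ hj
    rw [integral_const_mul, horth i j hj.symm, mul_zero]
  · exact fun h => absurd hi h

/-! ### The circuit -/

lemma foldl_induction {Y : Type*} (p : Y → Prop) : ∀ (L : ℕ) (f : Y → Fin L → Y) (a : Y),
    p a → (∀ y l, p y → p (f y l)) → p (Fin.foldl L f a) := by
  intro L
  induction L with
  | zero => intro f a ha _; simpa using ha
  | succ L ih =>
    intro f a ha hf
    rw [Fin.foldl_succ_last]
    exact hf _ _ (ih _ _ ha fun y l hy => hf y l.castSucc hy)

lemma continuous_foldl {X Y : Type*} [TopologicalSpace X] [TopologicalSpace Y] :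
    ∀ (L : ℕ) (f : X → Y → Fin L → Y) (a : Y),
    (∀ l, Continuous fun q : X × Y => f q.1 q.2 l) → Continuous fun x => Fin.foldl L (f x) a := by
  intro L
  induction L with
  | zero => intro f a _; simpa using continuous_const
  | succ L ih =>
    intro f a hf
    simp only [Fin.foldl_succ_last]
    exact (hf (Fin.last L)).comp (continuous_id.prodMk
      (ih (fun x y l => f x y l.castSucc) a fun l => hf l.castSucc))

namespace RandomCircuit

variable {n L : ℕ}

/-- The choices of all the two-qubit gates of the circuit. -/
abbrev PairGates (C : RandomCircuit n L) : Type :=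
  (l : Fin L) → Fin (C.layer l).numGates → U (Fin 2 × Fin 2)

/-- The law of the two-qubit gates. -/
def pairLaw (C : RandomCircuit n L) : Measure C.PairGates :=
  Measure.pi fun l => Measure.pi (C.layer l).gateLaw

instance instIsProbabilityMeasureLayer (C : RandomCircuit n L) (l : Fin L) :
    IsProbabilityMeasure (Measure.pi (C.layer l).gateLaw) :=
  have := fun g => ((C.layer l).gateLaw_isTwoDesign g).isProbabilityMeasure
  inferInstance

instance instIsProbabilityMeasurePairLaw (C : RandomCircuit n L) :
    IsProbabilityMeasure C.pairLaw := by
  unfold pairLaw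
  infer_instance

instance instIsProbabilityMeasureSingle (C : RandomCircuit n L) :
    IsProbabilityMeasure (Measure.pi C.singleLaw) :=
  have := fun i => (C.singleLaw_isTwoDesign i).isProbabilityMeasure
  inferInstance

lemma law_eq (C : RandomCircuit n L) : C.law = C.pairLaw.prod (Measure.pi C.singleLaw) := rfl

instance instIsProbabilityMeasureLaw (C : RandomCircuit n L) : IsProbabilityMeasure C.law := by
  rw [law_eq]
  infer_instance

/-- The state before the final layer of single-qubit gates. -/
def noisyState (C : RandomCircuit n L) (N : QubitMap) (ω : C.PairGates) (ρ : Op n) : Op n :=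
  Fin.foldl L (fun A l => tensorChannel N
    ((C.layer l).unitary (ω l) * A * ((C.layer l).unitary (ω l)).conjTranspose)) ρ

lemma output_eq (C : RandomCircuit n L) (N : QubitMap) (ω : C.Gates) (ρ : Op n) :
    C.output N ω ρ = tensor (fun i => (ω.2 i).1) * C.noisyState N ω.1 ρ *
      (tensor fun i => (ω.2 i).1).conjTranspose := rfl

lemma isState_noisyState (C : RandomCircuit n L) {N : QubitMap} (hN : IsChannel N)
    (ω : C.PairGates) {ρ : Op n} (hρ : IsState ρ) : IsState (C.noisyState N ω ρ) :=
  foldl_induction IsState L _ ρ hρ fun _ l hA =>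
    hN.isState_tensorChannel (hA.conj ((C.layer l).unitary_conjTranspose_mul (ω l)))

lemma isState_output (C : RandomCircuit n L) {N : QubitMap} (hN : IsChannel N)
    (ω : C.Gates) {ρ : Op n} (hρ : IsState ρ) : IsState (C.output N ω ρ) := by
  rw [output_eq]
  refine (C.isState_noisyState hN ω.1 hρ).conj ?_
  rw [tensor_conjTranspose, tensor_mul]
  simp only [unitary_conjTranspose_mul, tensor_one]

lemma continuous_noisyState (C : RandomCircuit n L) (N : QubitMap) (ρ : Op n) :
    Continuous fun ω => C.noisyState N ω ρ := by
  refine continuous_foldl L (fun (ω : C.PairGates) A l => tensorChannel N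
    ((C.layer l).unitary (ω l) * A * ((C.layer l).unitary (ω l)).conjTranspose)) ρ fun l => ?_
  have h : Continuous fun q : C.PairGates × Op n => (C.layer l).unitary (q.1 l) :=
    (C.layer l).continuous_unitary.comp ((continuous_apply l).comp continuous_fst)
  exact (continuous_tensorChannel N).comp ((h.mul continuous_snd).mul h.matrix_conjTranspose)

lemma continuous_output (C : RandomCircuit n L) (N : QubitMap) (ρ : Op n) :
    Continuous fun ω => C.output N ω ρ := by
  simp only [output_eq]
  have h : Continuous fun ω : C.Gates => tensor fun i => (ω.2 i).1 :=
    continuous_tensor.comp continuous_snd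
  exact (h.mul ((C.continuous_noisyState N ρ).comp continuous_fst)).mul h.matrix_conjTranspose

/-- The second moment of the expectation value of a Pauli string. -/
def pauliVariance (C : RandomCircuit n L) (N : QubitMap) (ρ : Op n) (P : PauliString n) : ℝ :=
  ∫ ω, expVal (pauliOp P) (C.output N ω ρ) ^ 2 ∂C.law

lemma integral_pauli_mul_pauli (C : RandomCircuit n L) (N : QubitMap) (ρ : Op n)
    {P Q : PauliString n} (hPQ : P ≠ Q) :
    ∫ ω, expVal (pauliOp P) (C.output N ω ρ) * expVal (pauliOp Q) (C.output N ω ρ) ∂C.law = 0 := by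
  have hc : Continuous fun ω => expVal (pauliOp P) (C.output N ω ρ) *
      expVal (pauliOp Q) (C.output N ω ρ) :=
    ((continuous_expVal _).comp (C.continuous_output N ρ)).mul
      ((continuous_expVal _).comp (C.continuous_output N ρ))
  rw [law_eq, integral_prod _ (integrable_of_continuous hc)]
  simp only [output_eq]
  simp only [(locallyInvariant_tensor C.singleLaw_isTwoDesign _).integral_pauli_mul_pauli_one hPQ,
    integral_zero]

/-- The identity string has constant expectation `1`, so orthogonality to it says that all other
strings have mean zero. The rest is Pythagoras. -/
lemma costVariance_eq (C : RandomCircuit n L) {N : QubitMap} (hN : IsChannel N) {ρ : Op n}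
    (hρ : IsState ρ) (a : PauliString n → ℝ) :
    C.costVariance N ρ a = ∑ P with P ≠ 0, a P ^ 2 * C.pauliVariance N ρ P := by
  have hc : ∀ P : PauliString n, Continuous fun ω => expVal (pauliOp P) (C.output N ω ρ) :=
    fun P => (continuous_expVal _).comp (C.continuous_output N ρ)
  have h1 : ∀ ω, expVal (pauliOp 0) (C.output N ω ρ) = 1 := fun ω => by
    rw [pauliOp_zero, (C.isState_output hN ω hρ).expVal_one]
  have hmean : ∀ P : PauliString n, P ≠ 0 →
      ∫ ω, expVal (pauliOp P) (C.output N ω ρ) ∂C.law = 0 := by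
    intro P hP
    simpa [h1] using C.integral_pauli_mul_pauli N ρ hP
  have hE : ∫ ω, expVal (hamiltonian a) (C.output N ω ρ) ∂C.law = a 0 := by
    simp only [expVal_hamiltonian]
    rw [integral_finsetSum _ fun P _ => (integrable_of_continuous (hc P)).const_mul _]
    simp only [integral_const_mul]
    rw [Finset.sum_eq_single (0 : PauliString n)]
    · simp [h1]
    · intro P _ hP; rw [hmean P hP, mul_zero]
    · simp
  rw [costVariance, variance_eq_integral]
  · have e : ∀ ω, expVal (hamiltonian a) (C.output N ω ρ) - a 0 =
        ∑ P with P ≠ 0, a P * expVal (pauliOp P) (C.output N ω ρ) := by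
      intro ω
      rw [expVal_hamiltonian, ← Finset.sum_filter_add_sum_filter_not Finset.univ (fun P => P ≠ 0)
        (fun P => a P * expVal (pauliOp P) (C.output N ω ρ))]
      simp [h1, Finset.filter_eq']
    rw [hE]
    simp only [e]
    exact integral_sq_sum_of_orthogonal _ a (fun P ω => expVal (pauliOp P) (C.output N ω ρ))
      (fun P Q => integrable_of_continuous ((hc P).mul (hc Q)))
      (fun P Q hPQ => C.integral_pauli_mul_pauli N ρ hPQ)
  · exact ((continuous_expVal _).comp (C.continuous_output N ρ)).measurable.aemeasurable

/-- All strings in the support class share one second moment under the final gates, so it may be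
summed over the class; the sum of squares is then the same for every choice of final gates. -/
lemma pauliVariance_eq (C : RandomCircuit n L) (N : QubitMap) (ρ : Op n) (P : PauliString n) :
    3 ^ weight P * C.pauliVariance N ρ P =
      ∫ ω, ∑ Q ∈ supportClass P, expVal (pauliOp Q) (C.noisyState N ω ρ) ^ 2 ∂C.pairLaw := by
  have hc : ∀ P : PauliString n, Continuous fun ω => expVal (pauliOp P) (C.output N ω ρ) ^ 2 :=
    fun P => ((continuous_expVal _).comp (C.continuous_output N ρ)).pow 2
  rw [pauliVariance, law_eq, integral_prod _ (integrable_of_continuous (hc P)),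
    ← integral_const_mul]
  congr 1
  ext1 ω
  simp only [output_eq]
  have hinv := locallyInvariant_tensor C.singleLaw_isTwoDesign (C.noisyState N ω ρ)
  have hc' : ∀ Q : PauliString n, Continuous fun η : Fin n → U (Fin 2) => expVal (pauliOp Q)
      ((tensor fun i => (η i).1) * C.noisyState N ω ρ * (tensor fun i => (η i).1).conjTranspose) ^ 2 :=
    fun Q => (continuous_expVal_conj continuous_tensor _ _).pow 2
  have hsum := Finset.sum_congr rfl fun Q (hQ : Q ∈ supportClass P) =>
    hinv.integral_sq_eq_of_mem_supportClass hQ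
  rw [Finset.sum_const, nsmul_eq_mul, card_supportClass] at hsum
  rw [← hsum, ← integral_finsetSum _ fun Q _ => integrable_of_continuous (hc' Q)]
  simp only [sum_supportClass_tensor_conj, integral_const, probReal_univ, one_smul]

/-- The state after the gates of the last layer and before their noise. -/
def lastState (C : RandomCircuit n (L + 1)) (N : QubitMap) (ω : C.PairGates) (ρ : Op n) : Op n :=
  (C.layer (Fin.last L)).unitary (ω (Fin.last L)) *
    Fin.foldl L (fun A l => tensorChannel N ((C.layer l.castSucc).unitary (ω l.castSucc) * A *
      ((C.layer l.castSucc).unitary (ω l.castSucc)).conjTranspose)) ρ *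
    ((C.layer (Fin.last L)).unitary (ω (Fin.last L))).conjTranspose

lemma noisyState_succ (C : RandomCircuit n (L + 1)) (N : QubitMap) (ω : C.PairGates) (ρ : Op n) :
    C.noisyState N ω ρ = tensorChannel N (C.lastState N ω ρ) := by
  rw [noisyState, Fin.foldl_succ_last]
  rfl

lemma isState_lastState (C : RandomCircuit n (L + 1)) {N : QubitMap} (hN : IsChannel N)
    (ω : C.PairGates) {ρ : Op n} (hρ : IsState ρ) : IsState (C.lastState N ω ρ) :=
  (foldl_induction IsState L _ ρ hρ fun _ l hA => hN.isState_tensorChannel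
    (hA.conj ((C.layer l.castSucc).unitary_conjTranspose_mul (ω l.castSucc)))).conj
      ((C.layer _).unitary_conjTranspose_mul _)

lemma continuous_lastState (C : RandomCircuit n (L + 1)) (N : QubitMap) (ρ : Op n) :
    Continuous fun ω => C.lastState N ω ρ := by
  have h : ∀ l, Continuous fun ω : C.PairGates => (C.layer l).unitary (ω l) := fun l =>
    (C.layer l).continuous_unitary.comp (continuous_apply l)
  refine ((h _).mul (continuous_foldl L (fun (ω : C.PairGates) A l => tensorChannel N
    ((C.layer l.castSucc).unitary (ω l.castSucc) * A *
      ((C.layer l.castSucc).unitary (ω l.castSucc)).conjTranspose)) ρ fun l => ?_)).mul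
    (h _).matrix_conjTranspose
  exact (continuous_tensorChannel N).comp ((((h l.castSucc).comp continuous_fst).mul
    continuous_snd).mul ((h l.castSucc).comp continuous_fst).matrix_conjTranspose)

/-- With the earlier layers fixed, this is the invariance of the last layer alone; resampling that
layer and integrating gives the claim. -/
lemma locallyInvariant_lastState (C : RandomCircuit n (L + 1)) (N : QubitMap) (ρ : Op n) :
    LocallyInvariant C.pairLaw fun ω => C.lastState N ω ρ := by
  intro i w R R'
  have hc := C.continuous_lastState N ρ
  have hF : Continuous fun ω => expVal R (C.lastState N ω ρ) * expVal R' (C.lastState N ω ρ) :=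
    ((continuous_expVal R).comp hc).mul ((continuous_expVal R').comp hc)
  have hc' : Continuous fun ω => site i w.1 * C.lastState N ω ρ * (site i w.1).conjTranspose :=
    (continuous_const.mul hc).mul continuous_const
  have hF' : Continuous fun ω =>
      expVal R (site i w.1 * C.lastState N ω ρ * (site i w.1).conjTranspose) *
      expVal R' (site i w.1 * C.lastState N ω ρ * (site i w.1).conjTranspose) :=
    ((continuous_expVal R).comp hc').mul ((continuous_expVal R').comp hc')
  have hu : ∀ (ω : C.PairGates) v, C.lastState N (Function.update ω (Fin.last L) v) ρ =
      (C.layer (Fin.last L)).unitary v *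
      Fin.foldl L (fun A l => tensorChannel N ((C.layer l.castSucc).unitary (ω l.castSucc) * A *
        ((C.layer l.castSucc).unitary (ω l.castSucc)).conjTranspose)) ρ *
      ((C.layer (Fin.last L)).unitary v).conjTranspose := by
    intro ω v
    have hl : ∀ l : Fin L, Function.update ω (Fin.last L) v l.castSucc = ω l.castSucc :=
      fun l => Function.update_of_ne (Fin.castSucc_lt_last l).ne _ _
    simp only [lastState, hl, Function.update_self]
  have h1 := integral_pi_update (fun l => Measure.pi (C.layer l).gateLaw) (Fin.last L)
    (integrable_of_continuous (μ := C.pairLaw) hF)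
  have h2 := integral_pi_update (fun l => Measure.pi (C.layer l).gateLaw) (Fin.last L)
    (integrable_of_continuous (μ := C.pairLaw) hF')
  refine h2.trans (Eq.trans ?_ h1.symm)
  refine integral_congr_ae (.of_forall fun ω => ?_)
  simp only [hu]
  exact (C.layer (Fin.last L)).locallyInvariant _ i w R R'

/-- The variance of each Pauli string decays exponentially in its weight, with the stated rates. -/
lemma pauliVariance_bounds (C : RandomCircuit n L) {N : QubitMap} {t D : EuclideanSpace ℝ (Fin 3)}
    {ρ : Op n} (hL : 1 ≤ L) (hN : IsChannel N) (h : HasNormalForm N t D) (hρ : IsState ρ)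
    (P : PauliString n) :
    (‖t‖ ^ 2 / 3) ^ weight P ≤ C.pauliVariance N ρ P ∧
      C.pauliVariance N ρ P ≤ contractionCoeff t D ^ weight P := by
  -- Depth at least one provides a random layer immediately before the last noise.
  obtain ⟨L, rfl⟩ := Nat.exists_eq_add_of_le' hL
  obtain ⟨v, hv⟩ := h.exists_expansion
  have h3 : (0 : ℝ) < 3 ^ weight P := by positivity
  let y : PauliString n → C.PairGates → ℝ := fun Q ω =>
    expVal (pauliOp Q) ((tensor fun _ => v.1.conjTranspose) * C.lastState N ω ρ *
      (tensor fun _ => v.1.conjTranspose).conjTranspose)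
  have hyc : ∀ Q, Continuous (y Q) := fun Q => (continuous_expVal _).comp
    ((continuous_const.mul (C.continuous_lastState N ρ)).mul continuous_const)
  have hstate : ∀ ω, IsState ((tensor fun _ => v.1.conjTranspose) * C.lastState N ω ρ *
      (tensor fun _ : Fin n => v.1.conjTranspose).conjTranspose) := by
    intro ω
    refine (C.isState_lastState hN ω hρ).conj ?_
    rw [tensor_conjTranspose, tensor_mul]
    simp only [Matrix.conjTranspose_conjTranspose, unitary_mul_conjTranspose, tensor_one]
  have hexp : 3 ^ weight P * C.pauliVariance N ρ P = ∑ Q ∈ supportClass P, ∑ Q' : PauliString n,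
      (∏ i, normalTransfer t D (Q i) (Q' i)) ^ 2 * ∫ ω, y Q' ω ^ 2 ∂C.pairLaw := by
    have hcQ : ∀ Q : PauliString n, Continuous fun ω =>
        (∑ Q' : PauliString n, (∏ i, normalTransfer t D (Q i) (Q' i)) * y Q' ω) ^ 2 :=
      fun Q => (continuous_finsetSum _ fun Q' _ => continuous_const.mul (hyc Q')).pow 2
    rw [pauliVariance_eq]
    simp only [noisyState_succ, hv]
    rw [integral_finsetSum _ fun Q _ => integrable_of_continuous (hcQ Q)]
    refine Finset.sum_congr rfl fun Q _ => ?_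
    -- The cross terms vanish in the frame rotated by `v`, since local invariance holds for
    -- arbitrary observables.
    exact integral_sq_sum_of_orthogonal _ _ y
      (fun Q Q' => integrable_of_continuous ((hyc Q).mul (hyc Q')))
      (fun Q Q' hQ => (C.locallyInvariant_lastState N ρ).integral_pauli_mul_pauli v hQ)
  have hm0 : ∫ ω, y 0 ω ^ 2 ∂C.pairLaw = 1 := by
    have : ∀ ω, y 0 ω = 1 := fun ω => by
      simp only [y, pauliOp_zero, (hstate ω).expVal_one]
    simp [this]
  have hm_nonneg : ∀ Q, 0 ≤ ∫ ω, y Q ω ^ 2 ∂C.pairLaw := fun Q =>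
    integral_nonneg fun ω => sq_nonneg _
  have hm_le : ∀ Q, ∫ ω, y Q ω ^ 2 ∂C.pairLaw ≤ 1 := by
    intro Q
    have := integral_mono (μ := C.pairLaw) (integrable_of_continuous ((hyc Q).pow 2))
      (integrable_const (1 : ℝ)) fun ω => (hstate ω).expVal_pauliOp_sq_le_one Q
    simpa using this
  constructor
  -- Only the column `Q' = 0` is kept; its second moment is exactly `1` for any state.
  · rw [div_pow, div_le_iff₀' h3, hexp, ← sum_supportClass_normalTransfer_zero t D P]
    refine Finset.sum_le_sum fun Q _ => ?_
    have := Finset.single_le_sum (f := fun Q' : PauliString n =>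
      (∏ i, normalTransfer t D (Q i) (Q' i)) ^ 2 * ∫ ω, y Q' ω ^ 2 ∂C.pairLaw)
      (fun Q' _ => mul_nonneg (sq_nonneg _) (hm_nonneg Q')) (Finset.mem_univ 0)
    simpa [hm0] using this
  -- All second moments are at most `1`, leaving the sum of the squared entries in the rows of the
  -- class.
  · rw [contractionCoeff, div_pow, le_div_iff₀' h3, hexp, ← sum_supportClass_normalTransfer t D P]
    exact Finset.sum_le_sum fun Q _ => Finset.sum_le_sum fun Q' _ =>
      mul_le_of_le_one_right (sq_nonneg _) (hm_le Q')

end RandomCircuit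

/-! ### Consequences -/

lemma div_three_le_contractionCoeff (t D : EuclideanSpace ℝ (Fin 3)) :
    ‖t‖ ^ 2 / 3 ≤ contractionCoeff t D := by
  rw [contractionCoeff]
  have := sq_nonneg ‖D‖
  linarith

lemma norm_pos_of_nonunital {N : QubitMap} {t D : EuclideanSpace ℝ (Fin 3)}
    (h : HasNormalForm N t D) (h1 : N 1 ≠ 1) : 0 < ‖t‖ := by
  rw [norm_pos_iff]
  rintro rfl
  obtain ⟨u, v, N', h0, -, hconj⟩ := h
  refine h1 ?_
  have h0' : N' 1 = 1 := by simpa [pauli_zero] using h0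
  rw [hconj, mul_one, unitary_conjTranspose_mul, h0', mul_one, unitary_mul_conjTranspose]

/-- Uniform exponential bounds on the variance of each Pauli string. -/
lemma exists_uniform_rates {τ : ℝ} (hτ : 0 < τ) : ∃ α β : ℝ, 0 < β ∧ β ≤ α ∧
    ∀ (n L : ℕ) (C : RandomCircuit n L) (N : QubitMap) (t D : EuclideanSpace ℝ (Fin 3))
      (ρ : Op n), 1 ≤ L → IsChannel N → HasNormalForm N t D → τ ≤ ‖t‖ → IsState ρ →
      ∀ P, Real.exp (-(α * weight P)) ≤ C.pauliVariance N ρ P ∧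
        C.pauliVariance N ρ P ≤ Real.exp (-(β * weight P)) := by
  -- Capping `τ` at `1` keeps `1 - 2/3 * σ ^ 2` positive and at least `σ ^ 2 / 3`, so that its
  -- logarithm is usable and `β ≤ α`.
  have hσ : 0 < min τ 1 := lt_min hτ one_pos
  have hσ1 : (min τ 1) ^ 2 ≤ 1 := pow_le_one₀ hσ.le (min_le_right _ _)
  have hσ0 : 0 < (min τ 1) ^ 2 := by positivity
  have hp : 0 < (min τ 1) ^ 2 / 3 := by positivity
  have hq : 0 < 1 - 2 / 3 * (min τ 1) ^ 2 := by linarith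
  have hexp : ∀ (x : ℝ), 0 < x → ∀ k : ℕ, Real.exp (-(-Real.log x * k)) = x ^ k := by
    intro x hx k
    rw [neg_mul, neg_neg, mul_comm, Real.exp_nat_mul, Real.exp_log hx]
  refine ⟨-Real.log ((min τ 1) ^ 2 / 3), -Real.log (1 - 2 / 3 * (min τ 1) ^ 2), ?_, ?_, ?_⟩
  · have := Real.log_neg hq (by linarith)
    linarith
  · exact neg_le_neg (Real.log_le_log hp (by linarith))
  · intro n L C N t D ρ hL hN h ht hρ P
    have hle : (min τ 1) ^ 2 ≤ ‖t‖ ^ 2 :=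
      pow_le_pow_left₀ hσ.le ((min_le_left _ _).trans ht) 2
    have hb := C.pauliVariance_bounds hL hN h hρ P
    rw [hexp _ hp, hexp _ hq]
    constructor
    · refine le_trans (pow_le_pow_left₀ hp.le ?_ _) hb.1
      linarith
    · refine hb.2.trans (pow_le_pow_left₀ ?_ ?_ _)
      · exact le_trans (by positivity) (div_three_le_contractionCoeff t D)
      · have := contractionCoeff_le hN h
        linarith

lemma weight_le {n : ℕ} (P : PauliString n) : weight P ≤ n := by
  simpa [weight] using Finset.card_filter_le Finset.univ fun i => P i ≠ 0

end NoisyCircuit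

end
open NoisyCircuit in
theorem mainTheorem2 :
    -- explicit two-sided bound, for every noise channel
    (∀ (n L : ℕ) (C : RandomCircuit n L) (N : QubitMap) (t D : EuclideanSpace ℝ (Fin 3))
        (ρ : Op n) (a : PauliString n → ℝ),
        1 ≤ L → IsChannel N → HasNormalForm N t D → IsState ρ →
        ∑ P with P ≠ 0, a P ^ 2 * (‖t‖ ^ 2 / 3) ^ weight P ≤ C.costVariance N ρ a ∧
        C.costVariance N ρ a ≤ ∑ P with P ≠ 0, a P ^ 2 * contractionCoeff t D ^ weight P) ∧
    -- for non-unital noise both bases lie strictly between 0 and 1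
    (∀ (N : QubitMap) (t D : EuclideanSpace ℝ (Fin 3)),
        IsChannel N → HasNormalForm N t D → N 1 ≠ 1 →
        0 < ‖t‖ ^ 2 / 3 ∧ ‖t‖ ^ 2 / 3 ≤ contractionCoeff t D ∧ contractionCoeff t D < 1) ∧
    -- the variance is `∑ a_P² exp(-Θ(|P|))`, the constants depending only on a lower bound of `‖t‖`
    (∀ τ : ℝ, 0 < τ → ∃ α β : ℝ, 0 < β ∧ β ≤ α ∧
        ∀ (n L : ℕ) (C : RandomCircuit n L) (N : QubitMap) (t D : EuclideanSpace ℝ (Fin 3))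
          (ρ : Op n),
          1 ≤ L → IsChannel N → HasNormalForm N t D → τ ≤ ‖t‖ → IsState ρ →
          ∃ f : PauliString n → ℝ,
            (∀ P, P ≠ 0 → β * weight P ≤ f P ∧ f P ≤ α * weight P) ∧
            ∀ a : PauliString n → ℝ,
              C.costVariance N ρ a = ∑ P with P ≠ 0, a P ^ 2 * Real.exp (-f P)) ∧
    -- local observables are not concentrated
    (∀ τ : ℝ, 0 < τ → ∀ k : ℕ, ∃ δ : ℝ, 0 < δ ∧
        ∀ (n L : ℕ) (C : RandomCircuit n L) (N : QubitMap) (t D : EuclideanSpace ℝ (Fin 3))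
          (ρ : Op n) (a : PauliString n → ℝ),
          1 ≤ L → IsChannel N → HasNormalForm N t D → τ ≤ ‖t‖ → IsState ρ →
          (∀ P, a P ≠ 0 → weight P ≤ k) →
          δ * ∑ P with P ≠ 0, a P ^ 2 ≤ C.costVariance N ρ a ∧
          C.costVariance N ρ a ≤ ∑ P with P ≠ 0, a P ^ 2) ∧
    -- global observables are exponentially concentrated
    (∀ τ : ℝ, 0 < τ → ∀ γ : ℝ, 0 < γ → ∃ α β : ℝ, 0 < β ∧ β ≤ α ∧
        ∀ (n L : ℕ) (C : RandomCircuit n L) (N : QubitMap) (t D : EuclideanSpace ℝ (Fin 3))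
          (ρ : Op n) (a : PauliString n → ℝ),
          1 ≤ L → IsChannel N → HasNormalForm N t D → τ ≤ ‖t‖ → IsState ρ →
          (∀ P, P ≠ 0 → a P ≠ 0 → γ * n ≤ weight P) →
          Real.exp (-α * n) * ∑ P with P ≠ 0, a P ^ 2 ≤ C.costVariance N ρ a ∧
          C.costVariance N ρ a ≤ Real.exp (-β * n) * ∑ P with P ≠ 0, a P ^ 2) := by
  refine ⟨?_, ?_, ?_, ?_, ?_⟩
  · intro n L C N t D ρ a hL hN h hρ
    rw [C.costVariance_eq hN hρ]
    have hb := C.pauliVariance_bounds hL hN h hρ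
    exact ⟨Finset.sum_le_sum fun P _ => mul_le_mul_of_nonneg_left (hb P).1 (sq_nonneg _),
      Finset.sum_le_sum fun P _ => mul_le_mul_of_nonneg_left (hb P).2 (sq_nonneg _)⟩
  · intro N t D hN h h1
    have ht := norm_pos_of_nonunital h h1
    have hc := contractionCoeff_le hN h
    have ht2 : 0 < ‖t‖ ^ 2 := by positivity
    exact ⟨by positivity, div_three_le_contractionCoeff t D, by linarith⟩
  · intro τ hτ
    obtain ⟨α, β, hβ, hβα, hb⟩ := exists_uniform_rates hτ
    refine ⟨α, β, hβ, hβα, fun n L C N t D ρ hL hN h ht hρ => ?_⟩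
    have hb := hb n L C N t D ρ hL hN h ht hρ
    have hpos : ∀ P, 0 < C.pauliVariance N ρ P := fun P => (Real.exp_pos _).trans_le (hb P).1
    -- The exponent is read off from the variance of each string, which is positive by the lower
    -- bound and does not involve `a`.
    refine ⟨fun P => -Real.log (C.pauliVariance N ρ P), fun P _ => ⟨?_, ?_⟩, fun a => ?_⟩
    · have := (Real.log_le_iff_le_exp (hpos P)).mpr (hb P).2
      linarith
    · have := (Real.le_log_iff_exp_le (hpos P)).mpr (hb P).1
      linarith
    · rw [C.costVariance_eq hN hρ]
      exact Finset.sum_congr rfl fun P _ => by rw [neg_neg, Real.exp_log (hpos P)]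
  · intro τ hτ k
    obtain ⟨α, β, hβ, hβα, hb⟩ := exists_uniform_rates hτ
    refine ⟨Real.exp (-(α * k)), Real.exp_pos _, fun n L C N t D ρ a hL hN h ht hρ ha => ?_⟩
    have hb := hb n L C N t D ρ hL hN h ht hρ
    rw [C.costVariance_eq hN hρ, Finset.mul_sum]
    constructor
    · refine Finset.sum_le_sum fun P _ => ?_
      by_cases haP : a P = 0
      · simp [haP]
      · rw [mul_comm]
        refine mul_le_mul_of_nonneg_left (le_trans ?_ (hb P).1) (sq_nonneg _)
        refine Real.exp_le_exp.mpr (neg_le_neg (mul_le_mul_of_nonneg_left ?_ (hβ.le.trans hβα)))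
        exact_mod_cast ha P haP
    · refine Finset.sum_le_sum fun P _ => mul_le_of_le_one_right (sq_nonneg _) ((hb P).2.trans ?_)
      rw [Real.exp_le_one_iff, neg_nonpos]
      positivity
  · intro τ hτ γ hγ
    obtain ⟨α, β, hβ, hβα, hb⟩ := exists_uniform_rates hτ
    -- A weight of at least `γ * n` gives the upper rate `β * γ`; a weight of at most `n` gives the
    -- lower rate `α`. The maximum keeps the two ordered when `γ` is large.
    refine ⟨max α (β * γ), β * γ, mul_pos hβ hγ, le_max_right _ _,
      fun n L C N t D ρ a hL hN h ht hρ ha => ?_⟩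
    have hb := hb n L C N t D ρ hL hN h ht hρ
    rw [C.costVariance_eq hN hρ, Finset.mul_sum, Finset.mul_sum]
    constructor
    · refine Finset.sum_le_sum fun P _ => ?_
      rw [mul_comm]
      refine mul_le_mul_of_nonneg_left (le_trans ?_ (hb P).1) (sq_nonneg _)
      rw [neg_mul]
      refine Real.exp_le_exp.mpr (neg_le_neg (mul_le_mul (le_max_left _ _) ?_ (by positivity)
        ((hβ.le.trans hβα).trans (le_max_left _ _))))
      exact_mod_cast weight_le P
    · refine Finset.sum_le_sum fun P hP => ?_
      by_cases haP : a P = 0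
      · simp [haP]
      · rw [mul_comm (Real.exp _)]
        refine mul_le_mul_of_nonneg_left ((hb P).2.trans ?_) (sq_nonneg _)
        rw [neg_mul, mul_assoc]
        exact Real.exp_le_exp.mpr (neg_le_neg (mul_le_mul_of_nonneg_left
          (ha P (Finset.mem_filter.mp hP).2 haP) hβ.le))
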